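/- Let $(\Omega,\mathcal F)$ be a measurable space with a sequence of real random variables $X_1,X_2,\dots$, and let $\overline{\mathcal P}$ be the family of all probability measures $P$ on $(\Omega,\mathcal F)$ under which $(X_n)_{n\ge 1}$ is a sequence of i.i.d. integrable random variables with mean zero. Put $S_k=X_1+\dots+X_k$ and $\log^a x:=(\log x)^a$. Let $\zeta$ be the Riemann zeta function. For $\varepsilon>0$ put $$c_\varepsilon=\frac{(1+\varepsilon)^{5/4}+(1+\varepsilon)^{3/4}}{\sqrt2},\qquad \ell_\varepsilon=\log\frac{2\zeta(1+\varepsilon)}{\log(1+\varepsilon)},$$ and for $P\in\overline{\mathcal P}$ and $m\ge 2$ $$P_m^{(\varepsilon)}=P\left[\sup_{k\ge m}\frac{|S_k|}{c_\varepsilon\sqrt{k\,[\log\log((1+\varepsilon)^2k)+\ell_\varepsilon]}}\ge 1\right].$$ (1) Let $P\in\overline{\mathcal P}$ with $\mathrm{Var}_P[X_1]\le 1$. Then for every $\varepsilon>0$ and every $\delta>0$, $$\sum_{m=2}^\infty\frac{P_m^{(\varepsilon)}}{m\log m}\le\sum_{m=2}^\infty\frac{\log^\varepsilon(1+\varepsilon)\,\varepsilon^{-1}\zeta(1+\varepsilon)}{m\log^{1+\varepsilon}(2m/3)}+\frac{262}{\varepsilon^2}\left(\sum_{m=2}^\infty\frac{m^{-4/3}}{\log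 m}+\sum_{m=2}^\infty\frac{1+\mathsf E_P[X_1^2\log^\delta(X_1^2+1)]}{(1/3)^\delta\, m\log^{1+\delta}m}\right),$$ where the last series, and hence the right-hand side, is $+\infty$ if $\mathsf E_P[X_1^2\log^\delta(X_1^2+1)]=\infty$. (2) Consequently, let $\mathcal P\subset\overline{\mathcal P}$ be a collection of probability measures with $\mathrm{Var}_P[X_1]=1$ for all $P\in\mathcal P$ and $\sup_{P\in\mathcal P}\mathsf E_P[X_1^2\log^\delta(X_1^2+1)]<\infty$ for some $\delta>0$. Then for every $\varepsilon>0$, $$\sup_{P\in\mathcal P}\sum_{m=2}^\infty\frac{P_m^{(\varepsilon)}}{m\log m}<\infty.$$ -/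

import Mathlib

open MeasureTheory ProbabilityTheory
open scoped ENNReal

noncomputable section

namespace BaumKatzLIL

/-- The Riemann zeta function at a real argument, as a real number. -/
def zetaReal (s : ℝ) : ℝ := (riemannZeta (s : ℂ)).re

/-- For `s > 1` this is the usual Dirichlet series. -/
theorem zetaReal_eq_tsum {s : ℝ} (hs : 1 < s) :
    zetaReal s = ∑' j : ℕ, 1 / ((j : ℝ) + 1) ^ s := by
  have h := zeta_eq_tsum_one_div_nat_add_one_cpow (s := (s : ℂ)) (by simpa using hs)
  have h2 : ∀ j : ℕ, (1 : ℂ) / ((j : ℂ) + 1) ^ (s : ℂ)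
      = ((1 / ((j : ℝ) + 1) ^ s : ℝ) : ℂ) := by
    intro j
    have hj : (0 : ℝ) ≤ (j : ℝ) + 1 := by positivity
    rw [Complex.ofReal_div, Complex.ofReal_cpow hj]
    push_cast
    rfl
  simp_rw [h2] at h
  rw [← Complex.ofReal_tsum] at h
  rw [zetaReal, h, Complex.ofReal_re]

variable {Ω : Type*} [MeasurableSpace Ω]

/-- The class of all probability measures under which `X 0, X 1, X 2, …`
(the first variable is `X 0`) is an i.i.d. sequence of integrable random variables
with expected value zero. -/
def centeredIID (X : ℕ → Ω → ℝ) : Set (Measure Ω) :=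
  {P | IsProbabilityMeasure P ∧ iIndepFun X P ∧ (∀ n, IdentDistrib (X n) (X 0) P P) ∧
    Integrable (X 0) P ∧ ∫ ω, X 0 ω ∂P = 0}

/-- The partial sum of the first `k` variables. -/
def partialSum (X : ℕ → Ω → ℝ) (k : ℕ) (ω : Ω) : ℝ := ∑ i ∈ Finset.range k, X i ω

/-- `c_ε = ((1+ε)^{5/4} + (1+ε)^{3/4}) / √2`. -/
def cConst (ε : ℝ) : ℝ :=
  ((1 + ε) ^ (5 / 4 : ℝ) + (1 + ε) ^ (3 / 4 : ℝ)) / Real.sqrt 2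

/-- `ℓ_ε = log (2 ζ(1+ε) / log (1+ε))`. -/
def ellConst (ε : ℝ) : ℝ := Real.log (2 * zetaReal (1 + ε) / Real.log (1 + ε))

/-- The iterated-logarithm boundary `c_ε √(k (log log ((1+ε)² k) + ℓ_ε))`. -/
def lilBoundary (ε : ℝ) (k : ℕ) : ℝ :=
  cConst ε * Real.sqrt (k * (Real.log (Real.log ((1 + ε) ^ 2 * k)) + ellConst ε))

/-- The probability that the supremum over `k ≥ m` of `|S_k|` divided by the boundary
is at least one; the supremum is taken in `[0, ∞]`. -/
def crossingProb (X : ℕ → Ω → ℝ) (P : Measure Ω) (ε : ℝ) (m : ℕ) : ℝ≥0∞ :=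
  P {ω | 1 ≤ ⨆ k : ℕ, ⨆ _ : m ≤ k, ENNReal.ofReal (|partialSum X k ω| / lilBoundary ε k)}

/-- The expectation of `X₁² log^δ (X₁² + 1)`, as an element of `[0, ∞]`. -/
def logMoment (X : ℕ → Ω → ℝ) (P : Measure Ω) (δ : ℝ) : ℝ≥0∞ :=
  ∫⁻ ω, ENNReal.ofReal (X 0 ω ^ 2 * Real.log (X 0 ω ^ 2 + 1) ^ δ) ∂P

/-- The series `∑_{m ≥ 2} P_m / (m log m)` in `[0, ∞]`. -/
def crossingSeries (X : ℕ → Ω → ℝ) (P : Measure Ω) (ε : ℝ) : ℝ≥0∞ :=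
  ∑' m : Set.Ici (2 : ℕ), crossingProb X P ε m / ENNReal.ofReal ((m : ℝ) * Real.log (m : ℝ))

end BaumKatzLIL

end

/-! Write `L = lilLog ε`, so the boundary is `c_ε √(k L(k))`. Everything follows from a bound for a
single `m` (`crossingProb_le`): the crossing probability is at most `ζ(1+ε)/ε · (log(1+ε)/log m)^ε +
262/ε² · (m^{-1/3} + E[X₁²; X₁² > m^{1/3}])`. Dividing by `m log m` and summing gives (1), since
`log^δ(m^{1/3})` times the truncated moment is at most the log moment. The resulting right side
depends on `P` only through that moment and is a convergent series when it is finite, which gives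
(2).

For the single-`m` bound, cut `X_i` at two levels depending on `N = max(i+1, m)`: a lower one `κ'
√(N/L(N))` and an upper one `κ √N`. Centered low parts have exponential moments, so a maximal
inequality on geometric blocks gives probabilities `2 exp(-(1+ε) L(ρ^t))` (`low_block_le`); the
constant `ℓ_ε` makes these sum to the zeta term (`sum_exp_lilLog_le`). Centered middle parts are
handled by the Hájek–Rényi inequality (`mid_le`): a fixed value is in the middle range only for a
window of `N` so short that its weighted count is bounded (`sum_weight_le`). High parts vanish
except on an event bounded by a union bound (`high_exists_le`). As `X_i` has mean zero, the
centering costs only the means of the high parts, which are `O(√k)` with a small factor.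

The three contributions use up fractions `β`, `x` and `τ/κ` of `c_ε`, where `τ` is the truncated
moment. If the claimed bound is at least one there is nothing to prove; otherwise `τ < ε²/262` and
`m` is large in terms of `ε`, and explicit parameters fit, chosen separately for `ε ≤ 4` and `ε ≥
4`. -/

namespace BaumKatzLIL

/-! ### Maximal inequalities for sums of independent bounded variables. -/

section Past

variable {Ω : Type*}

/-- The σ-algebra generated by the first `k` members of a sequence. -/
abbrev past {Ω : Type*} (Y : ℕ → Ω → ℝ) (k : ℕ) : MeasurableSpace Ω :=
  MeasurableSpace.comap (fun ω (i : Finset.range k) => Y i ω) inferInstance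

theorem measurable_past {Y : ℕ → Ω → ℝ} {i k : ℕ} (h : i < k) :
    Measurable[past Y k] (Y i) := by
  have h1 : Measurable[past Y k] (fun ω (i : Finset.range k) => Y i ω) :=
    comap_measurable _
  exact (measurable_pi_apply (⟨i, Finset.mem_range.2 h⟩ : Finset.range k)).comp h1

theorem past_mono (Y : ℕ → Ω → ℝ) {k l : ℕ} (h : k ≤ l) : past Y k ≤ past Y l := by
  apply Measurable.comap_le
  refine @measurable_pi_lambda _ _ _ (past Y l) _ _ fun i => ?_
  exact measurable_past ((Finset.mem_range.1 i.2).trans_le h)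

theorem measurable_sum_past (Y : ℕ → Ω → ℝ) (k : ℕ) :
    Measurable[past Y k] (fun ω => ∑ i ∈ Finset.range k, Y i ω) :=
  Finset.measurable_fun_sum _ fun _ hi => measurable_past (Finset.mem_range.1 hi)

variable [MeasurableSpace Ω]

theorem past_le {Y : ℕ → Ω → ℝ} (hY : ∀ i, Measurable (Y i)) (k : ℕ) :
    past Y k ≤ ‹MeasurableSpace Ω› := by
  apply Measurable.comap_le
  exact measurable_pi_lambda _ fun i => hY i

/-- A functional of the first `k` variables is independent of `Y k`. With `U` the indicator of a
past event times a past functional, this replaces conditional expectations in the supermartingale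
steps below. -/
theorem integral_past_mul {Y : ℕ → Ω → ℝ} {P : Measure Ω} (hY : ∀ i, Measurable (Y i))
    (hind : iIndepFun Y P) {k : ℕ} {U : Ω → ℝ} (hU : Measurable[past Y k] U)
    {g : ℝ → ℝ} (hg : Measurable g) :
    ∫ ω, U ω * g (Y k ω) ∂P = (∫ ω, U ω ∂P) * ∫ ω, g (Y k ω) ∂P := by
  have hi : Indep (past Y k) (MeasurableSpace.comap (Y k) inferInstance) P := by
    have h1 := hind.indepFun_finset (Finset.range k) {k} (by simp) hY
    have h2 : IndepFun (fun ω (i : Finset.range k) => Y i ω) (Y k) P :=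
      h1.comp (φ := id) (ψ := fun f : ({k} : Finset ℕ) → ℝ => f ⟨k, Finset.mem_singleton_self k⟩)
        measurable_id (measurable_pi_apply (X := fun _ : ({k} : Finset ℕ) => ℝ) _)
    exact (IndepFun_iff_Indep _ _ _).1 h2
  have h3 : IndepFun U (fun ω => g (Y k ω)) P := by
    rw [IndepFun_iff_Indep]
    refine indep_of_indep_of_le_left (indep_of_indep_of_le_right hi ?_) hU.comap_le
    exact (hg.comp (comap_measurable (Y k))).comap_le
  exact h3.integral_fun_mul_eq_mul_integral (hU.mono (past_le hY k) le_rfl).aestronglyMeasurable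
    (hg.comp (hY k)).aestronglyMeasurable

/-- The maximal inequality for nonnegative supermartingales, started inside an event. -/
theorem measureReal_inter_exists_ge_one_le {P : Measure Ω} [IsFiniteMeasure P]
    {ℱ : ℕ → MeasurableSpace Ω} (hmono : Monotone ℱ) (hle : ∀ k, ℱ k ≤ ‹MeasurableSpace Ω›)
    {Z : ℕ → Ω → ℝ} (hZ : ∀ k, Measurable[ℱ k] (Z k)) (hint : ∀ k, Integrable (Z k) P)
    (h0 : ∀ k ω, 0 ≤ Z k ω) (n d m : ℕ) (hmn : m + d = n)
    (hsup : ∀ k, m ≤ k → k < n → ∀ A, MeasurableSet[ℱ k] A →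
      ∫ ω in A, Z (k + 1) ω ∂P ≤ ∫ ω in A, Z k ω ∂P)
    {A : Set Ω} (hA : MeasurableSet[ℱ m] A) :
    P.real (A ∩ {ω | ∃ k, m ≤ k ∧ k ≤ n ∧ 1 ≤ Z k ω}) ≤ ∫ ω in A, Z m ω ∂P := by
  have key : ∀ (m : ℕ) (B : Set Ω), MeasurableSet B →
      P.real (B ∩ {ω | 1 ≤ Z m ω}) ≤ ∫ ω in B ∩ {ω | 1 ≤ Z m ω}, Z m ω ∂P := by
    intro m B hB
    have hm : MeasurableSet (B ∩ {ω | 1 ≤ Z m ω}) :=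
      hB.inter (measurableSet_le measurable_const ((hZ m).mono (hle m) le_rfl))
    have := setIntegral_mono_on (integrable_const (1 : ℝ)).integrableOn (hint m).integrableOn hm
      (fun ω hω => hω.2)
    simpa using this
  induction d generalizing m A with
  | zero =>
    have hA' := hle m A hA
    have e : A ∩ {ω | ∃ k, m ≤ k ∧ k ≤ n ∧ 1 ≤ Z k ω} = A ∩ {ω | 1 ≤ Z m ω} := by
      ext ω
      simp only [Set.mem_inter_iff, Set.mem_ofPred_eq, and_congr_right_iff]
      intro _
      constructor
      · rintro ⟨k, h1, h2, h3⟩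
        obtain rfl : k = m := by omega
        exact h3
      · intro h
        exact ⟨m, le_rfl, by omega, h⟩
    rw [e]
    refine (key m A hA').trans ?_
    exact setIntegral_mono_set (hint m).integrableOn (ae_of_all _ (h0 m))
      (Filter.Eventually.of_forall Set.inter_subset_left)
  | succ d ih =>
    have hA' := hle m A hA
    have hB : MeasurableSet[ℱ m] {ω | 1 ≤ Z m ω} :=
      hZ m measurableSet_Ici
    have hB' := hle m _ hB
    have hAB : MeasurableSet[ℱ m] (A \ {ω | 1 ≤ Z m ω}) := hA.diff hB
    have h1 := ih (m + 1) (by omega) (fun k hk hk' => hsup k (by omega) hk')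
      (hmono (Nat.le_succ m) _ hAB)
    have h2 := hsup m le_rfl (by omega) _ hAB
    -- Split `A` by whether `Z m` has already reached one: that part is charged to `Z m` by Markov,
    -- and the rest is passed on to time `m + 1`.
    have hsub : A ∩ {ω | ∃ k, m ≤ k ∧ k ≤ n ∧ 1 ≤ Z k ω} ⊆
        (A ∩ {ω | 1 ≤ Z m ω}) ∪
        ((A \ {ω | 1 ≤ Z m ω}) ∩ {ω | ∃ k, m + 1 ≤ k ∧ k ≤ n ∧ 1 ≤ Z k ω}) := by
      rintro ω ⟨hωA, k, hk1, hk2, hk3⟩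
      by_cases h : 1 ≤ Z m ω
      · exact Or.inl ⟨hωA, h⟩
      · refine Or.inr ⟨⟨hωA, h⟩, k, ?_, hk2, hk3⟩
        rcases hk1.eq_or_lt with rfl | h'
        · exact absurd hk3 h
        · exact h'
    calc P.real (A ∩ {ω | ∃ k, m ≤ k ∧ k ≤ n ∧ 1 ≤ Z k ω})
        ≤ _ := measureReal_mono hsub
      _ ≤ _ := measureReal_union_le _ _
      _ ≤ (∫ ω in A ∩ {ω | 1 ≤ Z m ω}, Z m ω ∂P) + ∫ ω in A \ {ω | 1 ≤ Z m ω}, Z m ω ∂P :=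
        add_le_add (key m A hA') (h1.trans h2)
      _ = ∫ ω in A, Z m ω ∂P := integral_inter_add_sdiff hB' (hint m).integrableOn

theorem measureReal_exists_ge_one_le {P : Measure Ω} [IsFiniteMeasure P]
    {ℱ : ℕ → MeasurableSpace Ω} (hmono : Monotone ℱ) (hle : ∀ k, ℱ k ≤ ‹MeasurableSpace Ω›)
    {Z : ℕ → Ω → ℝ} (hZ : ∀ k, Measurable[ℱ k] (Z k)) (hint : ∀ k, Integrable (Z k) P)
    (h0 : ∀ k ω, 0 ≤ Z k ω) {m n : ℕ} (hmn : m ≤ n)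
    (hsup : ∀ k, m ≤ k → k < n → ∀ A, MeasurableSet[ℱ k] A →
      ∫ ω in A, Z (k + 1) ω ∂P ≤ ∫ ω in A, Z k ω ∂P) :
    P.real {ω | ∃ k, m ≤ k ∧ k ≤ n ∧ 1 ≤ Z k ω} ≤ ∫ ω, Z m ω ∂P := by
  have := measureReal_inter_exists_ge_one_le hmono hle hZ hint h0 n (n - m) m (by omega) hsup
    (A := Set.univ) MeasurableSet.univ
  simpa using this

theorem abs_sum_le_of_bounded {Ω : Type*} {Y : ℕ → Ω → ℝ} {M : ℕ → ℝ} (hM : ∀ i ω, |Y i ω| ≤ M i)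
    (k : ℕ) (ω : Ω) : |∑ i ∈ Finset.range k, Y i ω| ≤ ∑ i ∈ Finset.range k, M i :=
  (Finset.abs_sum_le_sum_abs _ _).trans (Finset.sum_le_sum fun i _ => hM i ω)

theorem integrable_of_abs_le {P : Measure Ω} [IsFiniteMeasure P] {f : Ω → ℝ}
    (hf : Measurable f) {C : ℝ} (hC : ∀ ω, |f ω| ≤ C) : Integrable f P :=
  Integrable.of_bound hf.aestronglyMeasurable C (ae_of_all _ fun ω => by simpa using hC ω)

/-- Maximal inequality for sums of independent variables with exponential moments. -/
theorem measureReal_exists_exp_le {Y : ℕ → Ω → ℝ} {P : Measure Ω} [IsProbabilityMeasure P]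
    (hY : ∀ i, Measurable (Y i)) (hind : iIndepFun Y P) {M : ℕ → ℝ} (hM : ∀ i ω, |Y i ω| ≤ M i)
    {l a A : ℝ} {n : ℕ}
    (hmgf : ∀ i < n, ∫ ω, Real.exp (l * Y i ω) ∂P ≤ Real.exp a) :
    P.real {ω | ∃ k ≤ n, A ≤ l * (∑ i ∈ Finset.range k, Y i ω) - a * k} ≤ Real.exp (-A) := by
  -- The factor `exp(-A)` is built in, so that crossing the line is the event `1 ≤ Z k` and `Z 0 =
  -- exp(-A)`.
  set Z : ℕ → Ω → ℝ := fun k ω => Real.exp (l * (∑ i ∈ Finset.range k, Y i ω) - a * k - A)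
  have hZm : ∀ k, Measurable[past Y k] (Z k) := fun k =>
    Real.measurable_exp.comp ((((measurable_sum_past Y k).const_mul l).sub_const _).sub_const _)
  have hZm' : ∀ k, Measurable (Z k) := fun k => (hZm k).mono (past_le hY k) le_rfl
  have hint : ∀ k, Integrable (Z k) P := by
    intro k
    refine integrable_of_abs_le (hZm' k)
      (C := Real.exp (|l| * (∑ i ∈ Finset.range k, M i) - a * k - A)) fun ω => ?_
    rw [abs_of_pos (Real.exp_pos _)]
    apply Real.exp_le_exp.2
    have := abs_sum_le_of_bounded hM k ω
    have h2 : l * (∑ i ∈ Finset.range k, Y i ω) ≤ |l| * (∑ i ∈ Finset.range k, M i) :=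
      (le_abs_self _).trans (by rw [abs_mul]; gcongr)
    linarith
  have hsup : ∀ k, 0 ≤ k → k < n → ∀ B, MeasurableSet[past Y k] B →
      ∫ ω in B, Z (k + 1) ω ∂P ≤ ∫ ω in B, Z k ω ∂P := by
    intro k _ hk B hB
    have hB' := past_le hY k B hB
    have e : ∀ ω, B.indicator (Z (k + 1)) ω =
        (Real.exp (-a) * B.indicator (Z k) ω) * Real.exp (l * Y k ω) := by
      intro ω
      by_cases h : ω ∈ B
      · simp only [Set.indicator_of_mem h, Z]
        rw [← Real.exp_add, ← Real.exp_add, Finset.sum_range_succ]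
        congr 1
        push_cast
        ring
      · simp [Set.indicator_of_notMem h]
    rw [← integral_indicator hB', ← integral_indicator hB', integral_congr_ae (ae_of_all _ e),
      integral_past_mul hY hind (k := k) (U := fun ω => Real.exp (-a) * B.indicator (Z k) ω)
        (((hZm k).indicator hB).const_mul _) (g := fun y => Real.exp (l * y)) (by fun_prop),
      integral_const_mul]
    have hn : 0 ≤ ∫ ω, B.indicator (Z k) ω ∂P :=
      integral_nonneg fun ω => Set.indicator_nonneg (fun _ _ => (Real.exp_pos _).le) _
    calc _ ≤ Real.exp (-a) * (∫ ω, B.indicator (Z k) ω ∂P) * Real.exp a := by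
            gcongr
            exact hmgf k hk
      _ = _ := by
        rw [mul_right_comm, ← Real.exp_add]; simp
  have := measureReal_exists_ge_one_le (P := P) (fun _ _ h => past_mono Y h) (past_le hY) hZm hint
    (fun k ω => (Real.exp_pos _).le) (Nat.zero_le n) hsup
  simp only [Z, Finset.range_zero, Finset.sum_empty, mul_zero, Nat.cast_zero, sub_zero, zero_sub,
    integral_const, probReal_univ, one_smul, Real.one_le_exp_iff, sub_nonneg] at this
  refine le_trans (measureReal_mono ?_) this
  rintro ω ⟨k, hk, h⟩
  exact ⟨k, Nat.zero_le _, hk, h⟩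

/-- The Hájek–Rényi inequality. -/
theorem measureReal_exists_sq_ge_le {Y : ℕ → Ω → ℝ} {P : Measure Ω} [IsProbabilityMeasure P]
    (hY : ∀ i, Measurable (Y i)) (hind : iIndepFun Y P) {M : ℕ → ℝ} (hM : ∀ i ω, |Y i ω| ≤ M i)
    (hmean : ∀ i, ∫ ω, Y i ω ∂P = 0) {v a : ℕ → ℝ} (hv : ∀ i, ∫ ω, Y i ω ^ 2 ∂P ≤ v i)
    {m n : ℕ} (hmn : m ≤ n) (ha : ∀ k, m ≤ k → 0 < a k)
    (hamono : ∀ k, m ≤ k → a k ≤ a (k + 1)) :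
    P.real {ω | ∃ k, m ≤ k ∧ k ≤ n ∧ a k ≤ (∑ i ∈ Finset.range k, Y i ω) ^ 2} ≤
      (∑ i ∈ Finset.range m, v i) / a m + ∑ i ∈ Finset.Ico m n, v i / a (i + 1) := by
  have hv0 : ∀ i, 0 ≤ v i := fun i => (integral_nonneg fun ω => sq_nonneg _).trans (hv i)
  set S : ℕ → Ω → ℝ := fun k ω => ∑ i ∈ Finset.range k, Y i ω with hS
  have hSm : ∀ k, Measurable[past Y k] (S k) := measurable_sum_past Y
  have hSm' : ∀ k, Measurable (S k) := fun k => (hSm k).mono (past_le hY k) le_rfl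
  have hS2 : ∀ k, Integrable (fun ω => S k ω ^ 2) P := fun k =>
    integrable_of_abs_le ((hSm' k).pow_const 2) (C := (∑ i ∈ Finset.range k, M i) ^ 2) fun ω => by
      rw [abs_pow]
      have := abs_sum_le_of_bounded hM k ω
      gcongr
  have hY2 : ∀ k, Integrable (fun ω => Y k ω ^ 2) P := fun k =>
    integrable_of_abs_le ((hY k).pow_const 2) (C := (M k) ^ 2) fun ω => by
      rw [abs_pow]
      have := hM k ω
      gcongr
  have hSY : ∀ k, Integrable (fun ω => S k ω * Y k ω) P := fun k =>
    integrable_of_abs_le ((hSm' k).mul (hY k)) (C := (∑ i ∈ Finset.range k, M i) * M k) fun ω => by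
      rw [abs_mul]
      have h1 := abs_sum_le_of_bounded hM k ω
      have h2 := hM k ω
      exact mul_le_mul h1 h2 (abs_nonneg _) ((abs_nonneg _).trans h1)
  have step : ∀ k (B : Set Ω), MeasurableSet[past Y k] B →
      ∫ ω in B, S (k + 1) ω ^ 2 ∂P ≤ (∫ ω in B, S k ω ^ 2 ∂P) + P.real B * v k := by
    intro k B hB
    have hB' := past_le hY k B hB
    have e1 : ∀ ω, S (k + 1) ω ^ 2 = S k ω ^ 2 + 2 * (S k ω * Y k ω) + Y k ω ^ 2 := by
      intro ω
      simp only [hS, Finset.sum_range_succ]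
      ring
    have e2 : ∫ ω in B, S k ω * Y k ω ∂P = 0 := by
      rw [← integral_indicator hB']
      have : ∀ ω, B.indicator (fun ω => S k ω * Y k ω) ω = B.indicator (S k) ω * Y k ω :=
        fun ω => Set.indicator_mul_left _ _ _
      rw [integral_congr_ae (ae_of_all _ this)]
      rw [integral_past_mul hY hind (k := k) (U := B.indicator (S k)) ((hSm k).indicator hB)
        (g := fun y => y) measurable_id, hmean k, mul_zero]
    have e3 : ∫ ω in B, Y k ω ^ 2 ∂P = P.real B * ∫ ω, Y k ω ^ 2 ∂P := by
      rw [← integral_indicator hB']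
      have : ∀ ω, B.indicator (fun ω => Y k ω ^ 2) ω = B.indicator (fun _ => (1 : ℝ)) ω * Y k ω ^ 2 := by
        intro ω
        by_cases h : ω ∈ B <;> simp [h]
      rw [integral_congr_ae (ae_of_all _ this)]
      rw [integral_past_mul hY hind (k := k) (U := B.indicator (fun _ => (1 : ℝ)))
        (measurable_const.indicator hB) (g := fun y => y ^ 2) (by fun_prop),
        integral_indicator hB']
      simp
    simp_rw [e1]
    have i1 : Integrable (fun ω => S k ω ^ 2 + 2 * (S k ω * Y k ω)) P :=
      (hS2 k).add ((hSY k).const_mul 2)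
    rw [integral_add i1.integrableOn (hY2 k).integrableOn,
      integral_add (hS2 k).integrableOn ((hSY k).const_mul 2).integrableOn, integral_const_mul, e2,
      e3, mul_zero, add_zero]
    gcongr
    exact hv k
  -- Adding the normalised variances still to come compensates the growth of `S²`, which makes `Z` a
  -- supermartingale from `m` on.
  set Z : ℕ → Ω → ℝ := fun k ω => S k ω ^ 2 / a k + ∑ i ∈ Finset.Ico k n, v i / a (i + 1)
  -- `a` is positive only from `m` on, so earlier times are set to zero to keep the process
  -- nonnegative everywhere.
  set Z' : ℕ → Ω → ℝ := fun k ω => if m ≤ k then Z k ω else 0 with hZ'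
  have hZe : ∀ k, m ≤ k → Z' k = Z k := fun k hk => by funext ω; simp [hZ', hk]
  have hZe' : ∀ k, ¬ m ≤ k → Z' k = fun _ => 0 := fun k hk => by funext ω; simp [hZ', hk]
  have hZm : ∀ k, Measurable[past Y k] (Z' k) := by
    intro k
    by_cases hk : m ≤ k
    · rw [hZe k hk]
      exact (((hSm k).pow_const 2).div_const _).add_const _
    · rw [hZe' k hk]
      exact measurable_const
  have hint0 : ∀ k, Integrable (Z k) P := fun k => ((hS2 k).div_const _).add (integrable_const _)
  have hint : ∀ k, Integrable (Z' k) P := by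
    intro k
    by_cases hk : m ≤ k
    · rw [hZe k hk]; exact hint0 k
    · rw [hZe' k hk]; exact integrable_const _
  have hsum0 : ∀ k, m ≤ k → 0 ≤ ∑ i ∈ Finset.Ico k n, v i / a (i + 1) := fun k hk =>
    Finset.sum_nonneg fun i hi =>
      div_nonneg (hv0 i) (ha _ (by have := (Finset.mem_Ico.1 hi).1; omega)).le
  have h0 : ∀ k ω, 0 ≤ Z' k ω := by
    intro k ω
    by_cases hk : m ≤ k
    · rw [hZe k hk]
      exact add_nonneg (div_nonneg (sq_nonneg _) (ha k hk).le) (hsum0 k hk)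
    · rw [hZe' k hk]
  have hsup : ∀ k, m ≤ k → k < n → ∀ B, MeasurableSet[past Y k] B →
      ∫ ω in B, Z' (k + 1) ω ∂P ≤ ∫ ω in B, Z' k ω ∂P := by
    intro k hk hkn B hB
    rw [hZe k hk, hZe (k + 1) (by omega)]
    have hval : ∀ k, ∫ ω in B, Z k ω ∂P = (∫ ω in B, S k ω ^ 2 ∂P) / a k +
        P.real B * ∑ i ∈ Finset.Ico k n, v i / a (i + 1) := by
      intro k
      rw [integral_add ((hS2 k).div_const _).integrableOn (integrable_const _).integrableOn,
        integral_div, setIntegral_const, smul_eq_mul]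
    rw [hval, hval, Finset.sum_eq_sum_Ico_succ_bot hkn]
    have hak := ha k hk
    have hak1 := ha (k + 1) (by omega)
    have hI : 0 ≤ ∫ ω in B, S k ω ^ 2 ∂P := integral_nonneg fun ω => sq_nonneg _
    calc _ ≤ ((∫ ω in B, S k ω ^ 2 ∂P) + P.real B * v k) / a (k + 1) +
          P.real B * ∑ i ∈ Finset.Ico (k + 1) n, v i / a (i + 1) := by
            gcongr
            exact step k B hB
      _ = (∫ ω in B, S k ω ^ 2 ∂P) / a (k + 1) + P.real B * (v k / a (k + 1) +
          ∑ i ∈ Finset.Ico (k + 1) n, v i / a (i + 1)) := by ring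
      _ ≤ _ := by
        gcongr
        exact hamono k hk
  have hES : ∀ k, ∫ ω, S k ω ^ 2 ∂P ≤ ∑ i ∈ Finset.range k, v i := by
    intro k
    induction k with
    | zero => simp [hS]
    | succ k ih =>
      have := step k Set.univ MeasurableSet.univ
      simp only [setIntegral_univ, probReal_univ, one_mul] at this
      rw [Finset.sum_range_succ]
      linarith
  have main := measureReal_exists_ge_one_le (P := P) (fun _ _ h => past_mono Y h) (past_le hY)
    hZm hint h0 hmn hsup
  rw [hZe m le_rfl] at main
  have hval : ∫ ω, Z m ω ∂P = (∫ ω, S m ω ^ 2 ∂P) / a m +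
      ∑ i ∈ Finset.Ico m n, v i / a (i + 1) := by
    rw [integral_add ((hS2 m).div_const _) (integrable_const _), integral_div]
    simp
  rw [hval] at main
  refine le_trans (measureReal_mono ?_) (main.trans ?_)
  · rintro ω ⟨k, hk, hkn, h⟩
    refine ⟨k, hk, hkn, ?_⟩
    rw [hZe k hk]
    have := hsum0 k hk
    have h2 : 1 ≤ S k ω ^ 2 / a k := (one_le_div (ha k hk)).2 h
    simp only [Z]
    linarith
  · have := ha m le_rfl
    gcongr
    exact hES m

end Past

/-! ### Exponential moments, zeta bounds, growth of the boundary, block sums and level windows. -/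

section Analysis

theorem exp_le_one_add_add_sq_mul_exp_abs (u : ℝ) :
    Real.exp u ≤ 1 + u + u ^ 2 / 2 * Real.exp |u| := by
  rcases le_total 0 u with hu | hu
  · rw [abs_of_nonneg hu]
    -- For `u ≥ 0`, multiply the claim by `exp(-u)`: the right side then starts at one and has
    -- derivative `x (1 - exp(-x)) ≥ 0`.
    have hmono : MonotoneOn (fun x : ℝ => Real.exp (-x) * (1 + x) + x ^ 2 / 2) (Set.Ici 0) := by
      have hd : ∀ x : ℝ, HasDerivAt (fun x : ℝ => Real.exp (-x) * (1 + x) + x ^ 2 / 2)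
          (x * (1 - Real.exp (-x))) x := by
        intro x
        have h1 : HasDerivAt (fun x : ℝ => Real.exp (-x)) (Real.exp (-x) * (-1)) x :=
          (Real.hasDerivAt_exp _).comp x (hasDerivAt_neg x)
        have h2 := (h1.mul ((hasDerivAt_id x).const_add 1)).add
          (((hasDerivAt_id x).pow 2).div_const 2)
        refine h2.congr_deriv ?_
        norm_num
        ring
      refine monotoneOn_of_deriv_nonneg (convex_Ici 0)
        (fun x _ => (hd x).continuousAt.continuousWithinAt)
        (fun x _ => (hd x).differentiableAt.differentiableWithinAt) fun x hx => ?_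
      rw [(hd x).deriv]
      have hx0 : 0 < x := by simpa using hx
      have : Real.exp (-x) ≤ 1 := Real.exp_le_one_iff.2 (by linarith)
      exact mul_nonneg hx0.le (by linarith)
    have h := hmono (Set.mem_Ici.2 le_rfl) (Set.mem_Ici.2 hu) hu
    simp only [neg_zero, Real.exp_zero] at h
    have h3 : Real.exp u * Real.exp (-u) = 1 := by rw [← Real.exp_add]; simp
    have := mul_le_mul_of_nonneg_left h (Real.exp_pos u).le
    nlinarith [this]
  · have hv := Real.quadratic_le_exp_of_nonneg (x := -u) (by linarith)
    have h3 : Real.exp u * Real.exp (-u) = 1 := by rw [← Real.exp_add]; simp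
    have h4 : 1 ≤ Real.exp |u| := Real.one_le_exp (abs_nonneg _)
    have h5 : Real.exp u ≤ 1 + u + u ^ 2 / 2 := by
      have h6 : 0 < 1 + -u + (-u) ^ 2 / 2 := by nlinarith
      have h7 : Real.exp u * (1 + -u + (-u) ^ 2 / 2) ≤ 1 := by
        calc _ ≤ Real.exp u * Real.exp (-u) := by gcongr
          _ = 1 := h3
      -- The product of the two quadratics is `1 + u⁴/4`.
      have h8 : Real.exp u * (1 + -u + (-u) ^ 2 / 2) ≤
          (1 + u + u ^ 2 / 2) * (1 + -u + (-u) ^ 2 / 2) := by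
        nlinarith [sq_nonneg (u ^ 2)]
      exact le_of_mul_le_mul_right h8 h6
    nlinarith [sq_nonneg u]

/-- The mean is removed only at the end: `E exp(l f) ≤ 1 + l μ + l² e^u / 2 ≤ exp(l μ + l² e^u /
2)`, and `exp(l μ)` cancels against the centering. Hence the bound and the second moment are needed
for `f` itself only. -/
theorem integral_exp_centered_le {Ω : Type*} [MeasurableSpace Ω] {P : Measure Ω}
    [IsProbabilityMeasure P] {f : Ω → ℝ} (hf : Measurable f) {b l u : ℝ}
    (hb : ∀ ω, |f ω| ≤ b) (h2 : ∫ ω, f ω ^ 2 ∂P ≤ 1) (hu : |l| * b ≤ u) :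
    ∫ ω, Real.exp (l * (f ω - ∫ ω', f ω' ∂P)) ∂P ≤ Real.exp (l ^ 2 * Real.exp u / 2) := by
  set μ := ∫ ω', f ω' ∂P
  have i1 : Integrable f P := integrable_of_abs_le hf hb
  have hlf : ∀ ω, |l * f ω| ≤ u := fun ω => by
    rw [abs_mul]
    exact (mul_le_mul_of_nonneg_left (hb ω) (abs_nonneg _)).trans hu
  have i2 : Integrable (fun ω => f ω ^ 2) P :=
    integrable_of_abs_le (hf.pow_const 2) (C := b ^ 2) fun ω => by
      rw [abs_pow]
      have := hb ω
      gcongr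
  have i3 : Integrable (fun ω => Real.exp (l * f ω)) P :=
    integrable_of_abs_le (by fun_prop) (C := Real.exp u) fun ω => by
      rw [abs_of_pos (Real.exp_pos _)]
      exact Real.exp_le_exp.2 ((le_abs_self _).trans (hlf ω))
  have key : ∫ ω, Real.exp (l * f ω) ∂P ≤ 1 + l * μ + l ^ 2 * Real.exp u / 2 := by
    have i4 : Integrable (fun ω => 1 + l * f ω) P := (integrable_const _).add (i1.const_mul l)
    have i5 : Integrable (fun ω => (1 + l * f ω) + (l ^ 2 * Real.exp u / 2) * f ω ^ 2) P :=
      i4.add (i2.const_mul _)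
    calc _ ≤ ∫ ω, ((1 + l * f ω) + (l ^ 2 * Real.exp u / 2) * f ω ^ 2) ∂P := by
          refine integral_mono i3 i5 fun ω => ?_
          have h := exp_le_one_add_add_sq_mul_exp_abs (l * f ω)
          have h' : Real.exp |l * f ω| ≤ Real.exp u := Real.exp_le_exp.2 (hlf ω)
          have := mul_le_mul_of_nonneg_left h' (show 0 ≤ (l * f ω) ^ 2 / 2 by positivity)
          dsimp only
          linarith
      _ = 1 + l * μ + l ^ 2 * Real.exp u / 2 * ∫ ω, f ω ^ 2 ∂P := by
          rw [integral_add i4 (i2.const_mul _), integral_add (integrable_const _) (i1.const_mul l),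
            integral_const_mul, integral_const_mul]
          simp [μ]
      _ ≤ _ := by
          have := mul_le_mul_of_nonneg_left h2 (show 0 ≤ l ^ 2 * Real.exp u / 2 by positivity)
          linarith
  have e : ∀ ω, Real.exp (l * (f ω - μ)) = Real.exp (-(l * μ)) * Real.exp (l * f ω) := by
    intro ω
    rw [← Real.exp_add]
    congr 1
    ring
  simp_rw [e]
  rw [integral_const_mul]
  calc _ ≤ Real.exp (-(l * μ)) * Real.exp (l * μ + l ^ 2 * Real.exp u / 2) := by
        gcongr
        refine key.trans ?_
        have := Real.add_one_le_exp (l * μ + l ^ 2 * Real.exp u / 2)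
        linarith
    _ = _ := by
        rw [← Real.exp_add]
        congr 1
        ring

/-- A lower Riemann sum for `∫_a^b ε t^{-(1+ε)} dt`. It makes the sums for `ζ(1+ε)`, for the blocks
and for `1/(n log^{1+δ} n)` telescope. -/
theorem mul_sub_mul_rpow_le {ε a b : ℝ} (hε : 0 < ε) (ha : 0 < a) (hab : a ≤ b) :
    ε * (b - a) * b ^ (-(1 + ε)) ≤ a ^ (-ε) - b ^ (-ε) := by
  have hb : 0 < b := ha.trans_le hab
  have h1 : a ^ (-ε) = b ^ (-ε) * (b / a) ^ ε := by
    rw [Real.div_rpow hb.le ha.le, Real.rpow_neg hb.le, Real.rpow_neg ha.le]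
    have := (Real.rpow_pos_of_pos hb ε).ne'
    field_simp
  have h2 : b ^ (-(1 + ε)) = b ^ (-ε) / b := by
    rw [show -(1 + ε) = -ε - 1 by ring, Real.rpow_sub_one hb.ne']
  have h3 : 1 + ε * (1 - a / b) ≤ (b / a) ^ ε := by
    have h4 : 1 - a / b ≤ Real.log (b / a) := by
      have := Real.one_sub_inv_le_log_of_pos (show 0 < b / a by positivity)
      rwa [inv_div] at this
    rw [Real.rpow_def_of_pos (by positivity)]
    have := Real.add_one_le_exp (Real.log (b / a) * ε)
    nlinarith
  have h5 : 0 < b ^ (-ε) := Real.rpow_pos_of_pos hb _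
  rw [h1, h2]
  have e : ε * (b - a) * (b ^ (-ε) / b) = b ^ (-ε) * (ε * (1 - a / b)) := by
    field_simp
  rw [e]
  nlinarith

theorem one_le_zetaReal_and_le {ε : ℝ} (hε : 0 < ε) :
    1 ≤ zetaReal (1 + ε) ∧ zetaReal (1 + ε) ≤ 1 + 1 / ε := by
  rw [zetaReal_eq_tsum (by linarith)]
  have hpos : ∀ j : ℕ, 0 ≤ 1 / ((j : ℝ) + 1) ^ (1 + ε) := fun j => by positivity
  have hpart : ∀ n : ℕ, ∑ j ∈ Finset.range (n + 1), 1 / ((j : ℝ) + 1) ^ (1 + ε) ≤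
      1 + 1 / ε * (1 - ((n : ℝ) + 1) ^ (-ε)) := by
    intro n
    induction n with
    | zero => simp
    | succ n ih =>
      rw [Finset.sum_range_succ]
      have h := mul_sub_mul_rpow_le hε (show (0 : ℝ) < (n : ℝ) + 1 by positivity)
        (show (n : ℝ) + 1 ≤ (n : ℝ) + 1 + 1 by linarith)
      have e : 1 / (((n + 1 : ℕ) : ℝ) + 1) ^ (1 + ε) = ((n : ℝ) + 1 + 1) ^ (-(1 + ε)) := by
        rw [Real.rpow_neg (by positivity), one_div]
        push_cast
        rfl
      rw [e]
      have h' : ((n : ℝ) + 1 + 1) ^ (-(1 + ε)) ≤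
          1 / ε * (((n : ℝ) + 1) ^ (-ε) - ((n : ℝ) + 1 + 1) ^ (-ε)) := by
        rw [one_div, inv_mul_eq_div, le_div_iff₀ hε]
        linarith
      push_cast
      linarith
  have hle : ∀ n : ℕ, ∑ j ∈ Finset.range n, 1 / ((j : ℝ) + 1) ^ (1 + ε) ≤ 1 + 1 / ε := by
    intro n
    have h1 := hpart n
    have h2 : 0 < ((n : ℝ) + 1) ^ (-ε) := by positivity
    have h3 : 0 < 1 / ε := by positivity
    refine (Finset.sum_le_sum_of_subset_of_nonneg (Finset.range_mono (Nat.le_succ n))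
      fun i _ _ => hpos i).trans (h1.trans ?_)
    nlinarith
  have hs : Summable fun j : ℕ => 1 / ((j : ℝ) + 1) ^ (1 + ε) :=
    summable_of_sum_range_le hpos hle
  refine ⟨?_, Real.tsum_le_of_sum_range_le hpos hle⟩
  have := hs.le_tsum 0 fun j _ => hpos j
  simpa using this

/-- The iterated-logarithm factor of the boundary at a real argument. -/
noncomputable def lilLog (ε x : ℝ) : ℝ := Real.log (Real.log ((1 + ε) ^ 2 * x)) + ellConst ε

theorem lilBoundary_eq (ε : ℝ) (k : ℕ) :
    lilBoundary ε k = cConst ε * Real.sqrt (k * lilLog ε k) := rfl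

variable {ε : ℝ}

theorem log_one_add_pos (hε : 0 < ε) : 0 < Real.log (1 + ε) := Real.log_pos (by linarith)

theorem log_sq_mul {x : ℝ} (hε : 0 < ε) (hx : 1 ≤ x) :
    Real.log ((1 + ε) ^ 2 * x) = 2 * Real.log (1 + ε) + Real.log x := by
  rw [Real.log_mul (by positivity) (by positivity), Real.log_pow]
  push_cast
  ring

/-- The constant `ℓ_ε` is designed for this form: along a geometric sequence, `exp(-(1+ε) L)`
becomes a zeta-type summand. -/
theorem lilLog_eq (hε : 0 < ε) {x : ℝ} (hx : 1 ≤ x) :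
    lilLog ε x = Real.log (2 * zetaReal (1 + ε) * (2 + Real.log x / Real.log (1 + ε))) := by
  have h1 := log_one_add_pos hε
  have h2 := (one_le_zetaReal_and_le hε).1
  have h3 := Real.log_nonneg hx
  rw [lilLog, ellConst, log_sq_mul hε hx, ← Real.log_mul (by positivity) (by positivity)]
  congr 1
  field_simp

theorem lilLog_mono (hε : 0 < ε) {x y : ℝ} (hx : 1 ≤ x) (hxy : x ≤ y) :
    lilLog ε x ≤ lilLog ε y := by
  have h1 := log_one_add_pos hε
  have h2 := (one_le_zetaReal_and_le hε).1
  have h3 := Real.log_nonneg hx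
  rw [lilLog_eq hε hx, lilLog_eq hε (hx.trans hxy)]
  gcongr

theorem four_thirds_le_lilLog (hε : 0 < ε) {x : ℝ} (hx : 1 ≤ x) : 4 / 3 ≤ lilLog ε x := by
  have h1 := log_one_add_pos hε
  have h2 := (one_le_zetaReal_and_le hε).1
  have h3 := div_nonneg (Real.log_nonneg hx) h1.le
  rw [lilLog_eq hε hx]
  -- Since `ζ ≥ 1`, the argument is at least `2 · 2`, and `log 4 > 4/3`.
  have h4 : Real.log 4 ≤ Real.log (2 * zetaReal (1 + ε) * (2 + Real.log x / Real.log (1 + ε))) :=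
    Real.log_le_log (by norm_num) (by nlinarith)
  have h5 : Real.log 4 = 2 * Real.log 2 := by
    rw [show (4 : ℝ) = 2 ^ 2 by norm_num, Real.log_pow]; norm_num
  have := Real.log_two_gt_d9
  linarith

/-- Once the inner logarithm is at least two, `L(y) - L(x) ≤ log(y/x)/2 ≤ √(y/x) - 1`, and `L(x) ≥
1`. In particular `x / L(x)` is nondecreasing there. -/
theorem lilLog_le_mul_sqrt (hε : 0 < ε) {x y : ℝ} (hx : 1 ≤ x) (hxy : x ≤ y)
    (h2 : 2 ≤ Real.log ((1 + ε) ^ 2 * x)) :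
    lilLog ε y ≤ lilLog ε x * Real.sqrt (y / x) := by
  have hx0 : 0 < x := by linarith
  have hL := four_thirds_le_lilLog hε hx
  have hy := hx.trans hxy
  have hq : 1 ≤ y / x := (one_le_div hx0).2 hxy
  have e1 : Real.log ((1 + ε) ^ 2 * y) = Real.log ((1 + ε) ^ 2 * x) + Real.log (y / x) := by
    rw [log_sq_mul hε hx, log_sq_mul hε hy, Real.log_div (by linarith) hx0.ne']
    ring
  have hlq : 0 ≤ Real.log (y / x) := Real.log_nonneg hq
  have e2 : lilLog ε y ≤ lilLog ε x + Real.log (y / x) / 2 := by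
    rw [lilLog, lilLog, e1]
    have h3 : Real.log (Real.log ((1 + ε) ^ 2 * x) + Real.log (y / x)) =
        Real.log (Real.log ((1 + ε) ^ 2 * x)) +
        Real.log (1 + Real.log (y / x) / Real.log ((1 + ε) ^ 2 * x)) := by
      have hw : 0 < Real.log ((1 + ε) ^ 2 * x) := by linarith
      rw [← Real.log_mul hw.ne' (by positivity)]
      congr 1
      rw [mul_add, mul_one, mul_div_cancel₀ _ hw.ne']
    have h4 : Real.log (1 + Real.log (y / x) / Real.log ((1 + ε) ^ 2 * x)) ≤
        Real.log (y / x) / Real.log ((1 + ε) ^ 2 * x) := by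
      have := Real.log_le_sub_one_of_pos
        (show 0 < 1 + Real.log (y / x) / Real.log ((1 + ε) ^ 2 * x) by positivity)
      linarith
    have h5 : Real.log (y / x) / Real.log ((1 + ε) ^ 2 * x) ≤ Real.log (y / x) / 2 := by
      gcongr
    linarith
  have e3 : 1 + Real.log (y / x) / 2 ≤ Real.sqrt (y / x) := by
    have hs : 0 < Real.sqrt (y / x) := by positivity
    have := Real.log_le_sub_one_of_pos hs
    rw [Real.log_sqrt (by positivity)] at this
    linarith
  nlinarith

/-- The sum of the block probabilities. -/
theorem sum_exp_lilLog_le (hε : 0 < ε) {ρ : ℝ} (hρ : 1 < ρ) (hρη : ρ ≤ 1 + ε)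
    (hs : (2 : ℝ) ^ (-ε) * Real.log (1 + ε) ≤ Real.log ρ) {x : ℝ} (hx : 1 < x) {t₀ : ℕ}
    (ht₀ : x < ρ ^ (t₀ + 1)) (T : ℕ) :
    ∑ t ∈ Finset.Ico t₀ T, 2 * Real.exp (-((1 + ε) * lilLog ε (ρ ^ t))) ≤
      zetaReal (1 + ε) / ε * (Real.log (1 + ε) / Real.log x) ^ ε := by
  have hη := log_one_add_pos hε
  have hlρ : 0 < Real.log ρ := Real.log_pos hρ
  have hlx : 0 < Real.log x := Real.log_pos hx
  have hz := (one_le_zetaReal_and_le hε).1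
  set z := zetaReal (1 + ε)
  set s := Real.log ρ / Real.log (1 + ε) with hsdef
  have hs0 : 0 < s := by positivity
  have hs1 : s ≤ 1 := by
    rw [hsdef, div_le_one hη]
    exact Real.log_le_log (by linarith) hρη
  have hs2 : (2 : ℝ) ^ (-ε) ≤ s := by
    rw [hsdef, le_div_iff₀ hη]
    exact hs
  have hterm : ∀ t : ℕ, 2 * Real.exp (-((1 + ε) * lilLog ε (ρ ^ t))) =
      2 * (2 * z) ^ (-(1 + ε)) * (2 + t * s) ^ (-(1 + ε)) := by
    intro t
    rw [lilLog_eq hε (one_le_pow₀ hρ.le), Real.log_pow, mul_div_assoc, ← hsdef,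
      mul_assoc 2 _ ((2 + (t : ℝ) * s) ^ _), ← Real.mul_rpow (by positivity) (by positivity), Real.rpow_def_of_pos (by positivity)]
    congr 2
    ring
  have htel : ∀ t : ℕ, (2 + t * s) ^ (-(1 + ε)) ≤
      1 / (ε * s) * ((2 + t * s - s) ^ (-ε) - (2 + ((t + 1 : ℕ) : ℝ) * s - s) ^ (-ε)) := by
    intro t
    have ht : 0 ≤ (t : ℝ) * s := by positivity
    have h := mul_sub_mul_rpow_le hε (show 0 < 2 + t * s - s by linarith)
      (show 2 + t * s - s ≤ 2 + t * s by linarith)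
    have e : 2 + ((t + 1 : ℕ) : ℝ) * s - s = 2 + t * s := by push_cast; ring
    rw [e, one_div, inv_mul_eq_div, le_div_iff₀ (by positivity)]
    calc _ = ε * (2 + t * s - (2 + t * s - s)) * (2 + t * s) ^ (-(1 + ε)) := by ring
      _ ≤ _ := h
  have hsum : ∑ t ∈ Finset.Ico t₀ T, (2 + t * s) ^ (-(1 + ε)) ≤
      1 / (ε * s) * (2 + t₀ * s - s) ^ (-ε) := by
    rcases le_total T t₀ with h | h
    · rw [Finset.Ico_eq_empty_of_le h, Finset.sum_empty]
      have : 0 ≤ (t₀ : ℝ) * s := by positivity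
      have : 0 ≤ 2 + t₀ * s - s := by linarith
      positivity
    · refine (Finset.sum_le_sum fun t _ => htel t).trans ?_
      rw [← Finset.mul_sum]
      have hT : 0 ≤ 2 + (T : ℝ) * s - s := by
        have : 0 ≤ (T : ℝ) * s := by positivity
        linarith
      have := Finset.sum_Ico_sub (fun t : ℕ => -((2 + (t : ℝ) * s - s) ^ (-ε))) h
      have e : ∑ t ∈ Finset.Ico t₀ T, ((2 + (t : ℝ) * s - s) ^ (-ε) -
          (2 + ((t + 1 : ℕ) : ℝ) * s - s) ^ (-ε)) =
          (2 + (t₀ : ℝ) * s - s) ^ (-ε) - (2 + (T : ℝ) * s - s) ^ (-ε) := by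
        rw [← neg_sub_neg, ← this]
        exact Finset.sum_congr rfl fun t _ => by ring
      rw [e]
      have : 0 ≤ (2 + (T : ℝ) * s - s) ^ (-ε) := Real.rpow_nonneg hT _
      gcongr
      linarith
  -- `s ≤ 1` gives `(t₀ + 1) s ≤ 2 + t₀ s - s`; the 2 in this base comes from the factor `(1+ε)²` in
  -- the boundary.
  have hbase : Real.log x / Real.log (1 + ε) ≤ 2 + t₀ * s - s := by
    have h1 : Real.log x < ((t₀ + 1 : ℕ) : ℝ) * Real.log ρ := by
      rw [← Real.log_pow]
      exact Real.log_lt_log (by linarith) ht₀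
    have h2 : Real.log x / Real.log (1 + ε) ≤ ((t₀ + 1 : ℕ) : ℝ) * s := by
      rw [hsdef, ← mul_div_assoc]
      gcongr
    push_cast at h2
    linarith
  have hbase' : (2 + t₀ * s - s) ^ (-ε) ≤ (Real.log (1 + ε) / Real.log x) ^ ε := by
    rw [← inv_div, Real.inv_rpow (by positivity), ← Real.rpow_neg (by positivity)]
    exact Real.rpow_le_rpow_of_nonpos (by positivity) hbase (by linarith)
  -- The factor `2^{-ε}` left over after the two signs is at most `s`, and so cancels the `1/s` lost
  -- in the telescoping.
  have hcoef : 2 * (2 * z) ^ (-(1 + ε)) * (1 / (ε * s)) ≤ z / ε := by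
    have h1 : (2 * z) ^ (-(1 + ε)) ≤ 2 ^ (-(1 + ε)) :=
      Real.rpow_le_rpow_of_nonpos (by norm_num) (by linarith) (by linarith)
    have h2 : (2 : ℝ) * 2 ^ (-(1 + ε)) = 2 ^ (-ε) := by
      rw [show -(1 + ε) = -ε - 1 by ring, Real.rpow_sub_one (by norm_num)]
      ring
    have h3 : 2 * (2 * z) ^ (-(1 + ε)) ≤ s := by linarith
    calc _ ≤ s * (1 / (ε * s)) := by gcongr
      _ = 1 / ε := by field_simp
      _ ≤ z / ε := by gcongr
  calc _ = 2 * (2 * z) ^ (-(1 + ε)) * ∑ t ∈ Finset.Ico t₀ T, (2 + t * s) ^ (-(1 + ε)) := by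
        rw [Finset.mul_sum]
        exact Finset.sum_congr rfl fun t _ => hterm t
    _ ≤ 2 * (2 * z) ^ (-(1 + ε)) * (1 / (ε * s) * (2 + t₀ * s - s) ^ (-ε)) := by gcongr
    _ = 2 * (2 * z) ^ (-(1 + ε)) * (1 / (ε * s)) * (2 + t₀ * s - s) ^ (-ε) := by ring
    _ ≤ z / ε * (Real.log (1 + ε) / Real.log x) ^ ε := by
        have : 0 ≤ (2 + t₀ * s - s) ^ (-ε) := Real.rpow_nonneg (le_trans (by positivity) hbase) _
        gcongr

/-- Apply `log v ≤ v - 1` to `v = (3/8) q^{1/8}` and use `log(3/8) ≥ -1`. The exponent `1/8` later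
produces the square root of `κ / κ'`. -/
theorem log_le_three_mul_rpow {q : ℝ} (hq : 0 < q) : Real.log q ≤ 3 * q ^ (1 / 8 : ℝ) := by
  have h1 : 0 < q ^ (1 / 8 : ℝ) := by positivity
  have h2 := Real.log_le_sub_one_of_pos (show 0 < 3 / 8 * q ^ (1 / 8 : ℝ) by positivity)
  rw [Real.log_mul (by norm_num) h1.ne', Real.log_rpow hq] at h2
  have h3 : -1 ≤ Real.log (3 / 8) := by
    rw [Real.le_log_iff_exp_le (by norm_num), Real.exp_neg]
    have := Real.exp_one_gt_d9
    rw [inv_le_comm₀ (Real.exp_pos _) (by norm_num)]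
    norm_num
    linarith
  linarith

theorem sum_Ioc_inv_le_log {a b : ℕ} (ha : 0 < a) (hab : a ≤ b) :
    ∑ N ∈ Finset.Ioc a b, (1 / N : ℝ) ≤ Real.log (b / a) := by
  induction b, hab using Nat.le_induction with
  | base => simp [ha.ne']
  | succ b hab ih =>
    rw [Finset.sum_Ioc_succ_top hab]
    have hb : (0 : ℝ) < b := by exact_mod_cast ha.trans_le hab
    have ha' : (0 : ℝ) < a := by exact_mod_cast ha
    have h := Real.one_sub_inv_le_log_of_pos (show (0 : ℝ) < (b + 1) / b by positivity)
    have e : Real.log ((b + 1 : ℕ) / a) = Real.log (b / a) + Real.log ((b + 1) / b) := by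
      rw [← Real.log_mul (by positivity) (by positivity)]
      congr 1
      push_cast
      field_simp
    have e2 : 1 - ((b + 1 : ℝ) / b)⁻¹ = 1 / ((b + 1 : ℕ) : ℝ) := by
      push_cast
      field_simp
      ring
    rw [e]
    linarith

/-- The weighted number of levels between which a given value lies. -/
theorem sum_weight_le {G : ℕ → ℝ} {m n : ℕ} (hm : 0 < m) (hG1 : ∀ N, m ≤ N → 1 ≤ G N)
    (hGmono : ∀ N N', m ≤ N → N ≤ N' → G N ≤ G N')
    (hGsqrt : ∀ N N', m ≤ N → N ≤ N' → G N' ≤ G N * Real.sqrt (N' / N))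
    {κ' κ : ℝ} (hκ' : 0 < κ') (hκ : 0 < κ) (y : ℝ) :
    ∑ N ∈ Finset.Icc m n with κ' ^ 2 * (N / G N) < y ∧ y ≤ κ ^ 2 * N,
      (if N = m then 1 / G N else 1 / (N * G N)) ≤ 1 + 3 * Real.sqrt (κ / κ') := by
  set S := (Finset.Icc m n).filter fun N : ℕ => κ' ^ 2 * (N / G N) < y ∧ y ≤ κ ^ 2 * N with hS
  rcases S.eq_empty_or_nonempty with he | hne
  · rw [he, Finset.sum_empty]
    positivity
  set a := S.min' hne
  set b := S.max' hne
  have haS : a ∈ S := S.min'_mem hne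
  have hbS : b ∈ S := S.max'_mem hne
  have hab : a ≤ b := S.min'_le _ hbS
  rw [hS, Finset.mem_filter, Finset.mem_Icc] at haS hbS
  have ha : m ≤ a := haS.1.1
  have hapos : 0 < a := hm.trans_le ha
  have ha0 : (0 : ℝ) < a := by exact_mod_cast hapos
  have hb0 : (0 : ℝ) < b := by exact_mod_cast hapos.trans_le hab
  have hGa := hG1 a ha
  have hGb := hG1 b (ha.trans hab)
  have hsum : ∑ N ∈ S, (if N = m then 1 / G N else 1 / (N * G N)) ≤
      1 / G a + 1 / G a * ∑ N ∈ Finset.Ioc a b, (1 / N : ℝ) := by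
    have hsub : S ⊆ insert a (Finset.Ioc a b) := by
      intro N hN
      have h1 := S.min'_le _ hN
      have h2 := S.le_max' _ hN
      rw [Finset.mem_insert, Finset.mem_Ioc]
      rcases h1.eq_or_lt with h | h
      · exact Or.inl h.symm
      · exact Or.inr ⟨h, h2⟩
    calc _ ≤ ∑ N ∈ insert a (Finset.Ioc a b), (if N = m then 1 / G N else 1 / (N * G N)) := by
          refine Finset.sum_le_sum_of_subset_of_nonneg hsub fun N hN _ => ?_
          have hN' : m ≤ N := by
            rw [Finset.mem_insert, Finset.mem_Ioc] at hN
            omega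
          have := hG1 N hN'
          split_ifs <;> positivity
      _ = (if a = m then 1 / G a else 1 / (a * G a)) +
          ∑ N ∈ Finset.Ioc a b, (if N = m then 1 / G N else 1 / (N * G N)) := by
          rw [Finset.sum_insert (by simp)]
      _ ≤ _ := by
          rw [Finset.mul_sum]
          refine add_le_add ?_ (Finset.sum_le_sum fun N hN => ?_)
          · split_ifs
            · exact le_rfl
            · have : (1 : ℝ) ≤ a := by exact_mod_cast hapos
              gcongr
              nlinarith
          · rw [Finset.mem_Ioc] at hN
            rw [if_neg (by omega), ← one_div_mul_one_div_rev]
            have h1 := hGmono a N ha hN.1.le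
            have : (0 : ℝ) < N := by exact_mod_cast hapos.trans hN.1
            gcongr
  have hlog := sum_Ioc_inv_le_log hapos hab
  set q : ℝ := b / a with hq
  have hq1 : 1 ≤ q := by
    rw [hq, one_le_div ha0]
    exact_mod_cast hab
  -- The window conditions at its two ends give `q < (κ/κ')² G b`; as `G b ≤ G a √q`, one factor
  -- `√q` cancels. The weighted sum over the window is about `(1 + log q) / G a`, so this suffices.
  have hqR : Real.sqrt q ≤ (κ / κ') ^ 2 * G a := by
    have h1 : κ' ^ 2 * (b / G b) < κ ^ 2 * a := hbS.2.1.trans_le haS.2.2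
    have h2 : q < (κ / κ') ^ 2 * G b := by
      rw [hq, div_lt_iff₀ ha0, div_pow, div_mul_eq_mul_div, div_mul_eq_mul_div,
        lt_div_iff₀ (by positivity)]
      have := mul_lt_mul_of_pos_right h1 (show 0 < G b by linarith)
      have e : κ' ^ 2 * (b / G b) * G b = b * κ' ^ 2 := by field_simp
      rw [e] at this
      linarith
    have h3 := hGsqrt a b ha hab
    have h4 : 0 < Real.sqrt q := by positivity
    have h5 : Real.sqrt q * Real.sqrt q = q := Real.mul_self_sqrt (by positivity)
    have h6 : q ≤ (κ / κ') ^ 2 * G a * Real.sqrt q :=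
      h2.le.trans (by rw [mul_assoc]; gcongr)
    exact le_of_mul_le_mul_right (h5.le.trans h6) h4
  have hq8 : q ^ (1 / 8 : ℝ) ≤ Real.sqrt (κ / κ') * G a := by
    have e : q ^ (1 / 8 : ℝ) = (Real.sqrt q) ^ (1 / 4 : ℝ) := by
      rw [Real.sqrt_eq_rpow, ← Real.rpow_mul (by positivity)]
      norm_num
    rw [e]
    calc _ ≤ ((κ / κ') ^ 2 * G a) ^ (1 / 4 : ℝ) := by gcongr
      _ = Real.sqrt (κ / κ') * G a ^ (1 / 4 : ℝ) := by
        rw [Real.mul_rpow (by positivity) (by linarith), ← Real.rpow_natCast,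
          ← Real.rpow_mul (by positivity), Real.sqrt_eq_rpow]
        norm_num
      _ ≤ Real.sqrt (κ / κ') * G a := by
        gcongr
        calc G a ^ (1 / 4 : ℝ) ≤ G a ^ (1 : ℝ) :=
              Real.rpow_le_rpow_of_exponent_le hGa (by norm_num)
          _ = G a := Real.rpow_one _
  have hfin := log_le_three_mul_rpow (q := q) (by linarith)
  have hGi : 1 / G a ≤ 1 := by
    rw [div_le_one (by linarith)]
    exact hGa
  calc _ ≤ 1 / G a + 1 / G a * (3 * (Real.sqrt (κ / κ') * G a)) := by
        refine hsum.trans ?_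
        gcongr
        linarith
    _ = 1 / G a + 3 * Real.sqrt (κ / κ') := by field_simp
    _ ≤ _ := by gcongr

end Analysis

/-! ### Three-part truncation and comparison of truncation levels with blocks. -/

section Truncation

/-- The part of `x` of absolute value at most `b`. -/
noncomputable def lowPart (b x : ℝ) : ℝ := if |x| ≤ b then x else 0

/-- The part of `x` of absolute value in `(b, h]`. -/
noncomputable def midPart (b h x : ℝ) : ℝ := if b < |x| ∧ |x| ≤ h then x else 0

/-- The part of `x` of absolute value greater than `b` and `h`. -/
noncomputable def highPart (b h x : ℝ) : ℝ := if b < |x| ∧ h < |x| then x else 0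

theorem lowPart_add_midPart_add_highPart (b h x : ℝ) :
    lowPart b x + midPart b h x + highPart b h x = x := by
  unfold lowPart midPart highPart
  by_cases h1 : |x| ≤ b
  · simp [h1, h1.not_gt]
  · have h1' := lt_of_not_ge h1
    by_cases h2 : |x| ≤ h
    · simp [h1, h1', h2, h2.not_gt]
    · simp [h1, h1', h2, lt_of_not_ge h2]

theorem measurable_lowPart (b : ℝ) : Measurable (lowPart b) :=
  Measurable.ite (measurableSet_le (by fun_prop) measurable_const) measurable_id measurable_const

theorem measurable_midPart (b h : ℝ) : Measurable (midPart b h) :=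
  Measurable.ite ((measurableSet_lt measurable_const (measurable_id.abs : Measurable fun x : ℝ => |x|)).inter
    (measurableSet_le (measurable_id.abs : Measurable fun x : ℝ => |x|) measurable_const))
    measurable_id measurable_const

theorem measurable_highPart (b h : ℝ) : Measurable (highPart b h) :=
  Measurable.ite ((measurableSet_lt measurable_const (measurable_id.abs : Measurable fun x : ℝ => |x|)).inter
    (measurableSet_lt measurable_const (measurable_id.abs : Measurable fun x : ℝ => |x|)))
    measurable_id measurable_const

theorem abs_lowPart_le {b : ℝ} (hb : 0 ≤ b) (x : ℝ) : |lowPart b x| ≤ b := by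
  unfold lowPart
  split_ifs with h
  · exact h
  · simpa using hb

theorem abs_midPart_le {b h : ℝ} (hh : 0 ≤ h) (x : ℝ) : |midPart b h x| ≤ h := by
  unfold midPart
  split_ifs with h'
  · exact h'.2
  · simpa using hh

theorem lowPart_sq_le (b x : ℝ) : lowPart b x ^ 2 ≤ x ^ 2 := by
  unfold lowPart
  split_ifs
  · exact le_rfl
  · simpa using sq_nonneg x

/-- The number of indices whose level lies below a given value. -/
theorem card_level_le {m n : ℕ} {y : ℝ} (hy : 0 ≤ y) :
    (((Finset.range n).filter fun i => ((max (i + 1) m : ℕ) : ℝ) < y).card : ℝ) ≤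
      if (m : ℝ) < y then min (n : ℝ) y else 0 := by
  split_ifs with h
  · refine le_min ?_ ?_
    · have := Finset.card_filter_le (Finset.range n) fun i => ((max (i + 1) m : ℕ) : ℝ) < y
      rw [Finset.card_range] at this
      exact_mod_cast this
    · have hsub : ((Finset.range n).filter fun i => ((max (i + 1) m : ℕ) : ℝ) < y) ⊆
          Finset.range ⌊y⌋₊ := by
        intro i hi
        rw [Finset.mem_filter] at hi
        rw [Finset.mem_range, ← Nat.succ_le_iff, Nat.le_floor_iff hy]
        refine le_trans ?_ hi.2.le
        exact_mod_cast le_max_left _ _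
      have := Finset.card_le_card hsub
      rw [Finset.card_range] at this
      exact le_trans (by exact_mod_cast this) (Nat.floor_le hy)
  · rw [Finset.filter_eq_empty_iff.2]
    · simp
    · intro i _ h'
      refine h (lt_of_le_of_lt ?_ h')
      exact_mod_cast le_max_right _ _

/-- Monotonicity of `x / L(x)`, followed by `L(y) ≤ L(z)`. With `y` and `z` the ends of a block, it
bounds all truncation levels in use there. -/
theorem div_lilLog_le {ε : ℝ} (hε : 0 < ε) {N y z : ℝ} (hN : 1 ≤ N) (hNz : N ≤ z)
    (hlog : 2 ≤ Real.log ((1 + ε) ^ 2 * N)) (hy : 1 ≤ y) (hyz : y ≤ z) :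
    N / lilLog ε N ≤ z / lilLog ε y := by
  have hN0 : 0 < N := by linarith
  have hGN := four_thirds_le_lilLog hε hN
  have hGy := four_thirds_le_lilLog hε hy
  have hs1 : 1 ≤ z / N := (one_le_div hN0).2 hNz
  have hs : Real.sqrt (z / N) ≤ z / N := by
    rw [Real.sqrt_le_left (by linarith)]
    nlinarith
  rw [div_le_div_iff₀ (by linarith) (by linarith)]
  calc N * lilLog ε y ≤ N * (lilLog ε N * (z / N)) := by
        gcongr
        exact (lilLog_mono hε hy hyz).trans ((lilLog_le_mul_sqrt hε hN hNz hlog).trans (by gcongr))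
    _ = z * lilLog ε N := by field_simp

/-- On a block `[y, y r⁴)` the exponential parameter is tuned to the geometric midpoint `y r²`. With
`θ = √(k/(y r²))` in `[1/r, r]`, comparing the line in `k` with the boundary reduces to the
quadratic condition `hbd`. -/
theorem block_boundary_le {η y r C ψ β L L' k : ℝ} (hy : 0 < y) (hr : 1 < r) (hC : 0 < C)
    (hβ : 0 < β) (hbd : ∀ θ, 1 / r ≤ θ → θ ≤ r → η + C ^ 2 * ψ * θ ^ 2 / 2 ≤ C * β * θ)
    (hL : 0 < L) (hLL : L ≤ L') (hk1 : y ≤ k) (hk2 : k < y * r ^ 4) :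
    η * L + (C ^ 2 * (L / (y * r ^ 2)) * ψ / 2) * k ≤
      C * Real.sqrt (L / (y * r ^ 2)) * (β * Real.sqrt (k * L')) := by
  have hr0 : 0 < r := by linarith
  have hk : 0 < k := by linarith
  have hk0 : 0 < y * r ^ 2 := by positivity
  set θ := Real.sqrt (k / (y * r ^ 2)) with hθ
  have hθ2 : θ ^ 2 = k / (y * r ^ 2) := Real.sq_sqrt (by positivity)
  have hb := hbd θ (by
    refine Real.le_sqrt_of_sq_le ?_
    rw [div_pow, one_pow, div_le_div_iff₀ (by positivity) hk0]
    nlinarith [sq_nonneg r]) (by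
    refine Real.sqrt_le_iff.2 ⟨hr0.le, ?_⟩
    rw [div_le_iff₀ hk0]
    nlinarith)
  have e : Real.sqrt (L / (y * r ^ 2)) * Real.sqrt (k * L) = L * θ := by
    rw [← Real.sqrt_mul (by positivity),
      show L / (y * r ^ 2) * (k * L) = L ^ 2 * (k / (y * r ^ 2)) by ring,
      Real.sqrt_mul (by positivity), Real.sqrt_sq hL.le]
  calc η * L + (C ^ 2 * (L / (y * r ^ 2)) * ψ / 2) * k
      = L * (η + C ^ 2 * ψ * (k / (y * r ^ 2)) / 2) := by ring
    _ ≤ L * (C * β * θ) := by rw [← hθ2]; gcongr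
    _ = C * β * (L * θ) := by ring
    _ = C * Real.sqrt (L / (y * r ^ 2)) * (β * Real.sqrt (k * L)) := by rw [← e]; ring
    _ ≤ _ := by gcongr

end Truncation

/-! ### Estimates for the low, middle and high parts. -/

section Decomposition

variable {Ω : Type*} [MeasurableSpace Ω]

/-- The second moment of the part of `X 0` with square greater than `y`. -/
noncomputable def tailMoment (X : ℕ → Ω → ℝ) (P : Measure Ω) (y : ℝ) : ℝ :=
  ∫ ω, (if y < X 0 ω ^ 2 then X 0 ω ^ 2 else 0) ∂P

variable {X : ℕ → Ω → ℝ} {P : Measure Ω}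

theorem integrable_tail (hX : ∀ i, Measurable (X i)) (h2 : Integrable (fun ω => X 0 ω ^ 2) P)
    (y : ℝ) : Integrable (fun ω => if y < X 0 ω ^ 2 then X 0 ω ^ 2 else 0) P := by
  refine h2.mono (Measurable.aestronglyMeasurable (Measurable.ite
    (measurableSet_lt measurable_const ((hX 0).pow_const 2)) ((hX 0).pow_const 2)
    measurable_const)) (ae_of_all _ fun ω => ?_)
  split_ifs
  · exact le_rfl
  · simpa using sq_nonneg (X 0 ω)

theorem tailMoment_nonneg (y : ℝ) : 0 ≤ tailMoment X P y :=
  integral_nonneg fun ω => by dsimp only; split_ifs <;> positivity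

theorem tailMoment_anti (hX : ∀ i, Measurable (X i)) (h2 : Integrable (fun ω => X 0 ω ^ 2) P)
    {y z : ℝ} (h : y ≤ z) : tailMoment X P z ≤ tailMoment X P y := by
  refine integral_mono (integrable_tail hX h2 z) (integrable_tail hX h2 y) fun ω => ?_
  dsimp only
  split_ifs with h1 h3
  · exact le_rfl
  · exact absurd (h.trans_lt h1) h3
  · positivity
  · exact le_rfl

theorem tailMoment_le (hX : ∀ i, Measurable (X i)) (h2 : Integrable (fun ω => X 0 ω ^ 2) P)
    (y : ℝ) : tailMoment X P y ≤ ∫ ω, X 0 ω ^ 2 ∂P := by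
  refine integral_mono (integrable_tail hX h2 y) h2 fun ω => ?_
  dsimp only
  split_ifs
  · exact le_rfl
  · positivity

theorem integral_comp_eq (hid : ∀ n, IdentDistrib (X n) (X 0) P P) {g : ℝ → ℝ}
    (hg : Measurable g) (i : ℕ) : ∫ ω, g (X i ω) ∂P = ∫ ω, g (X 0 ω) ∂P :=
  ((hid i).comp hg).integral_eq

theorem sq_gt_of_highPart_ne_zero {b κ z : ℝ} {N : ℕ} (hκ : 0 < κ)
    (h : highPart b (κ * Real.sqrt N) z ≠ 0) : (N : ℝ) < z ^ 2 / κ ^ 2 := by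
  unfold highPart at h
  split_ifs at h with h'
  · have h1 := pow_lt_pow_left₀ h'.2 (by positivity) (n := 2) (by norm_num)
    rw [sq_abs, mul_pow, Real.sq_sqrt (by positivity)] at h1
    rw [lt_div_iff₀ (by positivity)]
    linarith
  · exact absurd rfl h

/-- For a fixed value `z`, at most `min(k, z²/κ²) ≤ √k · |z|/κ` indices have level below `|z|`, and
none unless `z² > κ² m`. -/
theorem sum_abs_integral_highPart_le (hX : ∀ i, Measurable (X i))
    (hid : ∀ n, IdentDistrib (X n) (X 0) P P) (h1 : Integrable (X 0) P)
    (h2 : Integrable (fun ω => X 0 ω ^ 2) P) {m k : ℕ} {κ : ℝ} (hκ : 0 < κ) (b : ℕ → ℝ) :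
    ∑ i ∈ Finset.range k, |∫ ω, highPart (b i) (κ * Real.sqrt (max (i + 1) m : ℕ)) (X i ω) ∂P| ≤
      Real.sqrt k * (tailMoment X P (κ ^ 2 * m) / κ) := by
  have hset : ∀ N : ℕ, MeasurableSet {ω | (N : ℝ) < X 0 ω ^ 2 / κ ^ 2} := fun N =>
    measurableSet_lt measurable_const (((hX 0).pow_const 2).div_const _)
  have hi3 : ∀ i, Integrable (fun ω => if ((max (i + 1) m : ℕ) : ℝ) < X 0 ω ^ 2 / κ ^ 2
      then |X 0 ω| else 0) P := fun i => by
    refine h1.mono (Measurable.ite (hset _) (hX 0).abs measurable_const).aestronglyMeasurable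
      (ae_of_all _ fun ω => ?_)
    split_ifs <;> simp
  have h3 : ∀ i, |∫ ω, highPart (b i) (κ * Real.sqrt (max (i + 1) m : ℕ)) (X i ω) ∂P| ≤
      ∫ ω, (if ((max (i + 1) m : ℕ) : ℝ) < X 0 ω ^ 2 / κ ^ 2 then |X 0 ω| else 0) ∂P := by
    intro i
    rw [integral_comp_eq hid (measurable_highPart _ _) i]
    refine (abs_integral_le_integral_abs).trans ?_
    refine integral_mono_of_nonneg (ae_of_all _ fun ω => abs_nonneg _) (hi3 i)
      (ae_of_all _ fun ω => ?_)
    dsimp only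
    by_cases h : highPart (b i) (κ * Real.sqrt (max (i + 1) m : ℕ)) (X 0 ω) = 0
    · rw [h]
      split_ifs <;> simp
    · rw [if_pos (sq_gt_of_highPart_ne_zero hκ h)]
      unfold highPart
      split_ifs <;> simp
  refine (Finset.sum_le_sum fun i _ => h3 i).trans ?_
  rw [← integral_finsetSum _ fun i _ => hi3 i, tailMoment, ← integral_div, ← integral_const_mul]
  refine integral_mono (integrable_finsetSum _ fun i _ => hi3 i)
    (((integrable_tail hX h2 _).div_const _).const_mul _) fun ω => ?_
  dsimp only
  set z := X 0 ω
  rw [← Finset.sum_filter, Finset.sum_const, nsmul_eq_mul]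
  have hc := card_level_le (m := m) (n := k) (y := z ^ 2 / κ ^ 2) (by positivity)
  have e : (m : ℝ) < z ^ 2 / κ ^ 2 ↔ κ ^ 2 * m < z ^ 2 := by
    rw [lt_div_iff₀ (by positivity), mul_comm]
  simp only [e] at hc
  refine (mul_le_mul_of_nonneg_right hc (abs_nonneg z)).trans ?_
  split_ifs
  · have h4 : min (k : ℝ) (z ^ 2 / κ ^ 2) ≤ Real.sqrt k * (|z| / κ) := by
      have h5 : (|z| / κ) ^ 2 = z ^ 2 / κ ^ 2 := by rw [div_pow, sq_abs]
      have h6 : Real.sqrt k ^ 2 = k := Real.sq_sqrt (by positivity)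
      rw [← h5, ← h6]
      rw [Real.sqrt_sq (Real.sqrt_nonneg _)]
      rcases le_total (Real.sqrt k) (|z| / κ) with h | h
      · exact (min_le_left _ _).trans (by rw [sq]; gcongr)
      · exact (min_le_right _ _).trans (by rw [sq]; gcongr)
    calc _ ≤ Real.sqrt k * (|z| / κ) * |z| := by gcongr
      _ = Real.sqrt k * (z ^ 2 / κ) := by rw [← sq_abs z]; ring
  · simp

variable [IsProbabilityMeasure P]

/-- The centered sums of the low parts, within one geometric block. -/
theorem low_block_le (hX : ∀ i, Measurable (X i)) (hind : iIndepFun X P)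
    (hid : ∀ n, IdentDistrib (X n) (X 0) P P) (h2 : Integrable (fun ω => X 0 ω ^ 2) P)
    (h21 : ∫ ω, X 0 ω ^ 2 ∂P ≤ 1) {ε : ℝ} (hε : 0 < ε) {m n : ℕ} (hm : 1 ≤ m)
    (hlog : 2 ≤ Real.log ((1 + ε) ^ 2 * m)) {r C ψ κ' β : ℝ} (hr : 1 < r) (hC : 0 < C)
    (hψ : 0 < ψ) (hκ' : 0 < κ') (hu : κ' * C * r ≤ Real.log ψ) (hβ : 0 < β)
    (hbd : ∀ θ, 1 / r ≤ θ → θ ≤ r → (1 + ε) + C ^ 2 * ψ * θ ^ 2 / 2 ≤ C * β * θ)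
    {t : ℕ} (ht : (m : ℝ) ≤ (r ^ 4) ^ (t + 1)) :
    P.real {ω | ∃ k : ℕ, m ≤ k ∧ k ≤ n ∧ (r ^ 4) ^ t ≤ k ∧ k < (r ^ 4) ^ (t + 1) ∧
      β * Real.sqrt (k * lilLog ε k) ≤ |∑ i ∈ Finset.range k,
        (lowPart (κ' * Real.sqrt ((max (i + 1) m : ℕ) / lilLog ε (max (i + 1) m : ℕ))) (X i ω) -
          ∫ ω', lowPart (κ' * Real.sqrt ((max (i + 1) m : ℕ) / lilLog ε (max (i + 1) m : ℕ)))
            (X i ω') ∂P)|} ≤ 2 * Real.exp (-((1 + ε) * lilLog ε ((r ^ 4) ^ t))) := by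
  set lo : ℕ → ℝ := fun i =>
    κ' * Real.sqrt ((max (i + 1) m : ℕ) / lilLog ε (max (i + 1) m : ℕ)) with hlo
  set μ : ℕ → ℝ := fun i => ∫ ω', lowPart (lo i) (X i ω') ∂P with hμ
  set Y : ℕ → Ω → ℝ := fun i ω => lowPart (lo i) (X i ω) - μ i with hYdef
  have hlo0 : ∀ i, 0 ≤ lo i := fun i => by positivity
  have hr0 : 0 < r := by linarith
  have hρ1 : 1 ≤ r ^ 4 := one_le_pow₀ hr.le
  have hYm : ∀ i, Measurable (Y i) := fun i =>
    ((measurable_lowPart _).comp (hX i)).sub_const _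
  have hYind : iIndepFun Y P :=
    hind.comp (fun i x => lowPart (lo i) x - μ i) fun i => (measurable_lowPart _).sub_const _
  have hYM : ∀ i ω, |Y i ω| ≤ lo i + |μ i| := fun i ω =>
    (abs_sub _ _).trans (by gcongr; exact abs_lowPart_le (hlo0 i) _)
  set y : ℝ := (r ^ 4) ^ t with hy
  have hy1 : 1 ≤ y := one_le_pow₀ hρ1
  have hy0 : 0 < y := by linarith
  have hys : (r ^ 4) ^ (t + 1) = y * r ^ 4 := pow_succ _ _
  rw [hys] at ht ⊢
  set Lt := lilLog ε y with hLt
  have hLt1 : 4 / 3 ≤ Lt := four_thirds_le_lilLog hε hy1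
  have hLt0 : 0 < Lt := by linarith
  set k0 : ℝ := y * r ^ 2 with hk0
  have hk00 : 0 < k0 := by positivity
  set l : ℝ := C * Real.sqrt (Lt / k0) with hl
  have hl0 : 0 < l := by positivity
  have hl2 : l ^ 2 = C ^ 2 * (Lt / k0) := by
    rw [hl, mul_pow, Real.sq_sqrt (by positivity)]
  have hm0 : (1 : ℝ) ≤ m := by exact_mod_cast hm
  -- This bounds the exponent by `log ψ`, so `ψ` is the factor by which truncation inflates the
  -- Gaussian exponent.
  have hllo : ∀ i < ⌊y * r ^ 4⌋₊, l * lo i ≤ Real.log ψ := by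
    intro i hi
    have hN : ((max (i + 1) m : ℕ) : ℝ) ≤ y * r ^ 4 := by
      push_cast
      refine max_le ?_ ht
      have h1 : ((i + 1 : ℕ) : ℝ) ≤ (⌊y * r ^ 4⌋₊ : ℝ) := by exact_mod_cast hi
      have h2 := Nat.floor_le (show 0 ≤ y * r ^ 4 by positivity)
      push_cast at h1
      linarith
    have hNm : (m : ℝ) ≤ ((max (i + 1) m : ℕ) : ℝ) := by exact_mod_cast le_max_right _ _
    set N : ℝ := ((max (i + 1) m : ℕ) : ℝ)
    have hN1 : 1 ≤ N := hm0.trans hNm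
    have hN0 : 0 < N := by linarith
    have hlogN : 2 ≤ Real.log ((1 + ε) ^ 2 * N) :=
      hlog.trans (Real.log_le_log (by positivity) (by gcongr))
    have hq : N / lilLog ε N ≤ k0 * r ^ 2 / Lt := by
      have := div_lilLog_le hε hN1 hN hlogN hy1 (show y ≤ y * r ^ 4 by nlinarith)
      rwa [hk0, show y * r ^ 2 * r ^ 2 = y * r ^ 4 by ring]
    have hloi : lo i ≤ κ' * Real.sqrt (k0 * r ^ 2 / Lt) :=
      mul_le_mul_of_nonneg_left (Real.sqrt_le_sqrt hq) hκ'.le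
    calc l * lo i ≤ (C * Real.sqrt (Lt / k0)) * (κ' * Real.sqrt (k0 * r ^ 2 / Lt)) := by
          rw [hl]
          exact mul_le_mul_of_nonneg_left hloi (by positivity)
      _ = κ' * C * (Real.sqrt (Lt / k0) * Real.sqrt (k0 * r ^ 2 / Lt)) := by ring
      _ = κ' * C * r := by
          rw [← Real.sqrt_mul (by positivity),
            show Lt / k0 * (k0 * r ^ 2 / Lt) = r ^ 2 by field_simp, Real.sqrt_sq hr0.le]
      _ ≤ _ := hu
  have hmgf : ∀ l' : ℝ, |l'| = l → ∀ i < ⌊y * r ^ 4⌋₊,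
      ∫ ω, Real.exp (l' * Y i ω) ∂P ≤ Real.exp (l ^ 2 * ψ / 2) := by
    intro l' hl' i hi
    have hf : Measurable fun ω => lowPart (lo i) (X i ω) := (measurable_lowPart _).comp (hX i)
    have hsq : ∫ ω, lowPart (lo i) (X i ω) ^ 2 ∂P ≤ 1 := by
      rw [integral_comp_eq hid (g := fun x => lowPart (lo i) x ^ 2)
        ((measurable_lowPart _).pow_const 2) i]
      refine (integral_mono_of_nonneg (ae_of_all _ fun ω => sq_nonneg _) h2
        (ae_of_all _ fun ω => lowPart_sq_le _ _)).trans h21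
    have := integral_exp_centered_le (P := P) hf (fun ω => abs_lowPart_le (hlo0 i) _) hsq
      (l := l') (u := Real.log ψ) (by rw [hl']; exact hllo i hi)
    rw [Real.exp_log hψ, ← sq_abs l', hl'] at this
    exact this
  have hA : ∀ l' : ℝ, |l'| = l → P.real {ω | ∃ k ≤ ⌊y * r ^ 4⌋₊, (1 + ε) * Lt ≤
      l' * (∑ i ∈ Finset.range k, Y i ω) - (l ^ 2 * ψ / 2) * k} ≤ Real.exp (-((1 + ε) * Lt)) :=
    fun l' hl' => measureReal_exists_exp_le hYm hYind hYM (hmgf l' hl')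
  -- The two signs of the parameter bound the two tails of the sum and give the factor 2.
  have h1 := hA l (abs_of_pos hl0)
  have h3 := hA (-l) (by rw [abs_neg, abs_of_pos hl0])
  refine le_trans (measureReal_mono ?_) ((measureReal_union_le _ _).trans
    (le_trans (add_le_add h1 h3) (by linarith)))
  rintro ω ⟨k, hmk, hkn, hk1, hk2, hk⟩
  have hk0' : 0 < (k : ℝ) := by linarith
  have hkfl : k ≤ ⌊y * r ^ 4⌋₊ := Nat.le_floor hk2.le
  have hLk : Lt ≤ lilLog ε k := lilLog_mono hε hy1 hk1
  have hlS : (1 + ε) * Lt + (l ^ 2 * ψ / 2) * k ≤ l * |∑ i ∈ Finset.range k, Y i ω| := by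
    rw [hl2]
    exact (block_boundary_le hy0 hr hC hβ hbd hLt0 hLk hk1 hk2).trans
      (mul_le_mul_of_nonneg_left hk hl0.le)
  rcases abs_cases (∑ i ∈ Finset.range k, Y i ω) with ⟨h, _⟩ | ⟨h, _⟩
  · rw [h] at hlS
    exact Or.inl ⟨k, hkfl, by linarith⟩
  · rw [h] at hlS
    exact Or.inr ⟨k, hkfl, by linarith⟩

theorem low_le (hX : ∀ i, Measurable (X i)) (hind : iIndepFun X P)
    (hid : ∀ n, IdentDistrib (X n) (X 0) P P) (h2 : Integrable (fun ω => X 0 ω ^ 2) P)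
    (h21 : ∫ ω, X 0 ω ^ 2 ∂P ≤ 1) {ε : ℝ} (hε : 0 < ε) {m n : ℕ} (hm : 2 ≤ m)
    (hlog : 2 ≤ Real.log ((1 + ε) ^ 2 * m)) {r C ψ κ' β : ℝ} (hr : 1 < r) (hC : 0 < C)
    (hψ : 0 < ψ) (hκ' : 0 < κ') (hu : κ' * C * r ≤ Real.log ψ) (hβ : 0 < β)
    (hbd : ∀ θ, 1 / r ≤ θ → θ ≤ r → (1 + ε) + C ^ 2 * ψ * θ ^ 2 / 2 ≤ C * β * θ)
    (hrε : r ^ 4 ≤ 1 + ε) (hs : (2 : ℝ) ^ (-ε) * Real.log (1 + ε) ≤ Real.log (r ^ 4)) :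
    P.real {ω | ∃ k : ℕ, m ≤ k ∧ k ≤ n ∧
      β * Real.sqrt (k * lilLog ε k) ≤ |∑ i ∈ Finset.range k,
        (lowPart (κ' * Real.sqrt ((max (i + 1) m : ℕ) / lilLog ε (max (i + 1) m : ℕ))) (X i ω) -
          ∫ ω', lowPart (κ' * Real.sqrt ((max (i + 1) m : ℕ) / lilLog ε (max (i + 1) m : ℕ)))
            (X i ω') ∂P)|} ≤
      zetaReal (1 + ε) / ε * (Real.log (1 + ε) / Real.log m) ^ ε := by
  have hρ1 : 1 < r ^ 4 := one_lt_pow₀ hr (by norm_num)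
  have hex : ∀ k : ℕ, 1 ≤ k → ∃ t : ℕ, (r ^ 4) ^ t ≤ (k : ℝ) ∧ (k : ℝ) < (r ^ 4) ^ (t + 1) :=
    fun k hk => exists_nat_pow_near (by exact_mod_cast hk) hρ1
  -- `t₀` indexes the block containing `m`, so every later block ends beyond `m`, as `low_block_le`
  -- needs.
  obtain ⟨t₀, ht0, ht0'⟩ := hex m (by omega)
  obtain ⟨T, hT⟩ := pow_unbounded_of_one_lt (n : ℝ) hρ1
  refine le_trans ?_ (sum_exp_lilLog_le hε hρ1 hrε hs
    (show (1 : ℝ) < m by exact_mod_cast (by omega : 1 < m)) ht0' T)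
  refine le_trans ?_ (Finset.sum_le_sum fun t ht => low_block_le (n := n) hX hind hid h2 h21 hε
    (by omega : 1 ≤ m) hlog hr hC hψ hκ' hu hβ hbd (t := t) ?_)
  · refine le_trans (measureReal_mono ?_ (measure_ne_top _ _)) (measureReal_biUnion_finset_le _ _)
    rintro ω ⟨k, hmk, hkn, hk⟩
    obtain ⟨t, h1, h3⟩ := hex k (by omega)
    refine Set.mem_biUnion (x := t) ?_ ⟨k, hmk, hkn, h1, h3, hk⟩
    rw [Finset.mem_coe, Finset.mem_Ico]
    constructor
    · have : (r ^ 4) ^ t₀ < (r ^ 4) ^ (t + 1) :=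
        ht0.trans_lt (lt_of_le_of_lt (by exact_mod_cast hmk) h3)
      have := (pow_lt_pow_iff_right₀ hρ1).1 this
      omega
    · have : (r ^ 4) ^ t < (r ^ 4) ^ T :=
        h1.trans_lt (lt_of_le_of_lt (by exact_mod_cast hkn) hT)
      exact (pow_lt_pow_iff_right₀ hρ1).1 this
  · exact ht0'.le.trans (pow_le_pow_right₀ hρ1.le (by
      have := (Finset.mem_Ico.1 ht).1
      omega))

/-- The centered sums of the middle parts. -/
theorem mid_le (hX : ∀ i, Measurable (X i)) (hind : iIndepFun X P)
    (hid : ∀ n, IdentDistrib (X n) (X 0) P P) (h2 : Integrable (fun ω => X 0 ω ^ 2) P)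
    {ε : ℝ} (hε : 0 < ε) {m n : ℕ} (hm : 1 ≤ m) (hmn : m ≤ n)
    (hlog : 2 ≤ Real.log ((1 + ε) ^ 2 * m)) {κ' κ x : ℝ} (hκ' : 0 < κ') (hκ : 0 < κ)
    (hx : 0 < x) :
    P.real {ω | ∃ k : ℕ, m ≤ k ∧ k ≤ n ∧
      x * Real.sqrt (k * lilLog ε k) ≤ |∑ i ∈ Finset.range k,
        (midPart (κ' * Real.sqrt ((max (i + 1) m : ℕ) / lilLog ε (max (i + 1) m : ℕ)))
            (κ * Real.sqrt (max (i + 1) m : ℕ)) (X i ω) -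
          ∫ ω', midPart (κ' * Real.sqrt ((max (i + 1) m : ℕ) / lilLog ε (max (i + 1) m : ℕ)))
            (κ * Real.sqrt (max (i + 1) m : ℕ)) (X i ω') ∂P)|} ≤
      (1 + 3 * Real.sqrt (κ / κ')) / x ^ 2 *
        tailMoment X P (κ' ^ 2 * (m / lilLog ε m)) := by
  set lo : ℕ → ℝ := fun N => κ' * Real.sqrt (N / lilLog ε N) with hlo
  set hi : ℕ → ℝ := fun N => κ * Real.sqrt N with hhi
  set f : ℕ → ℝ → ℝ := fun i => midPart (lo (max (i + 1) m)) (hi (max (i + 1) m)) with hf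
  set μ : ℕ → ℝ := fun i => ∫ ω', f i (X i ω') ∂P with hμ
  have hfm : ∀ i, Measurable (f i) := fun i => measurable_midPart _ _
  have hfb : ∀ i z, |f i z| ≤ hi (max (i + 1) m) := fun i z => abs_midPart_le (by positivity) _
  set V : ℕ → ℝ := fun N => ∫ ω, midPart (lo N) (hi N) (X 0 ω) ^ 2 ∂P with hV
  have hint : ∀ N, Integrable (fun ω => midPart (lo N) (hi N) (X 0 ω) ^ 2) P := fun N =>
    integrable_of_abs_le (((measurable_midPart _ _).comp (hX 0)).pow_const 2)
      (C := hi N ^ 2) fun ω => by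
        rw [abs_pow]
        have := abs_midPart_le (b := lo N) (h := hi N) (by positivity) (X 0 ω)
        gcongr
  set G : ℕ → ℝ := fun N => lilLog ε N with hG
  have hm1 : ∀ N : ℕ, m ≤ N → (1 : ℝ) ≤ N := fun N hN => by exact_mod_cast hm.trans hN
  have hG1 : ∀ N, m ≤ N → 4 / 3 ≤ G N := fun N hN => four_thirds_le_lilLog hε (hm1 N hN)
  have hGmono : ∀ N N', m ≤ N → N ≤ N' → G N ≤ G N' := fun N N' hN hNN =>
    lilLog_mono hε (hm1 N hN) (by exact_mod_cast hNN)
  have hGs : ∀ N N', m ≤ N → N ≤ N' → G N' ≤ G N * Real.sqrt (N' / N) := fun N N' hN hNN =>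
    lilLog_le_mul_sqrt hε (hm1 N hN) (by exact_mod_cast hNN)
      (hlog.trans (Real.log_le_log (by have := hm1 m le_rfl; positivity) (by gcongr)))
  have hHR := measureReal_exists_sq_ge_le (P := P) (Y := fun i ω => f i (X i ω) - μ i)
    (fun i => ((hfm i).comp (hX i)).sub_const _)
    (hind.comp (fun i z => f i z - μ i) fun i => (hfm i).sub_const _)
    (M := fun i => hi (max (i + 1) m) + |μ i|)
    (fun i ω => (abs_sub _ _).trans (by gcongr; exact hfb i _))
    (fun i => by
      have h1 : Integrable (fun ω => f i (X i ω)) P :=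
        integrable_of_abs_le ((hfm i).comp (hX i)) (hfb i <| X i ·)
      rw [integral_sub h1 (integrable_const _)]
      simp [hμ])
    (v := fun i => V (max (i + 1) m)) (a := fun k => x ^ 2 * (k * G k))
    (fun i => by
      have h1 : Integrable (fun ω => f i (X i ω)) P :=
        integrable_of_abs_le ((hfm i).comp (hX i)) (hfb i <| X i ·)
      have h3 : MemLp (fun ω => f i (X i ω)) 2 P :=
        MemLp.of_bound ((hfm i).comp (hX i)).aestronglyMeasurable _
          (ae_of_all _ fun ω => (hfb i (X i ω)))
      have h4 := variance_le_expectation_sq (μ := P) (X := fun ω => f i (X i ω)) h1.1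
      rw [variance_eq_integral h1.1.aemeasurable] at h4
      refine h4.trans (le_of_eq ?_)
      exact integral_comp_eq hid (g := fun z => f i z ^ 2) ((hfm i).pow_const 2) i)
    hmn
    (fun k hk => by have := hG1 k hk; have := hm1 k hk; positivity)
    (fun k hk => by
      have h1 := hGmono k (k + 1) hk (Nat.le_succ k)
      have h3 := hG1 k hk
      have h4 : (k : ℝ) ≤ ((k + 1 : ℕ) : ℝ) := by exact_mod_cast Nat.le_succ k
      gcongr)
  refine le_trans (measureReal_mono ?_) (hHR.trans ?_)
  · rintro ω ⟨k, hmk, hkn, hk⟩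
    refine ⟨k, hmk, hkn, ?_⟩
    have h1 := hG1 k hmk
    have h3 := pow_le_pow_left₀ (by positivity) hk 2
    rw [sq_abs, mul_pow, Real.sq_sqrt (by positivity)] at h3
    exact h3
  -- All indices `i < m` share the level `m`, so that level carries `m` times the generic weight.
  · set w : ℕ → ℝ := fun N => if N = m then 1 / G N else 1 / (N * G N) with hw
    have hGm := hG1 m le_rfl
    have hmm := hm1 m le_rfl
    have e1 : (∑ i ∈ Finset.range m, V (max (i + 1) m)) / (x ^ 2 * (m * G m)) +
        ∑ i ∈ Finset.Ico m n, V (max (i + 1) m) / (x ^ 2 * (((i + 1 : ℕ) : ℝ) * G (i + 1))) =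
        (∑ N ∈ Finset.Icc m n, w N * V N) / x ^ 2 := by
      have h1 : ∑ i ∈ Finset.range m, V (max (i + 1) m) = m * V m := by
        rw [Finset.sum_congr rfl (g := fun _ => V m)]
        · simp
        · intro i hi
          rw [max_eq_right (by have := Finset.mem_range.1 hi; omega)]
      have h3 : ∑ N ∈ Finset.Icc m n, w N * V N =
          w m * V m + ∑ i ∈ Finset.Ico m n, w (i + 1) * V (i + 1) := by
        rw [← Finset.Ico_add_one_right_eq_Icc, Finset.sum_eq_sum_Ico_succ_bot (by omega),
          Finset.sum_Ico_add' (fun N => w N * V N) m n 1]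
      rw [h1, h3, add_div]
      congr 1
      · simp only [hw, if_true]
        field_simp
      · rw [Finset.sum_div]
        refine Finset.sum_congr rfl fun i hi => ?_
        have hi' := Finset.mem_Ico.1 hi
        rw [max_eq_left (by omega)]
        simp only [hw]
        rw [if_neg (by omega)]
        have := hG1 (i + 1) (by omega)
        field_simp
    rw [e1, div_mul_eq_mul_div]
    gcongr
    have e2 : ∑ N ∈ Finset.Icc m n, w N * V N =
        ∫ ω, ∑ N ∈ Finset.Icc m n, w N * midPart (lo N) (hi N) (X 0 ω) ^ 2 ∂P := by
      rw [integral_finsetSum _ fun N _ => (hint N).const_mul _]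
      exact Finset.sum_congr rfl fun N _ => (integral_const_mul _ _).symm
    rw [e2, tailMoment, ← integral_const_mul]
    refine integral_mono (integrable_finsetSum _ fun N _ => (hint N).const_mul _)
      ((integrable_tail hX h2 _).const_mul _) fun ω => ?_
    dsimp only
    set z := X 0 ω
    have hmid : ∀ N ∈ Finset.Icc m n, w N * midPart (lo N) (hi N) z ^ 2 =
        if κ' ^ 2 * (N / G N) < z ^ 2 ∧ z ^ 2 ≤ κ ^ 2 * N then z ^ 2 * w N else 0 := by
      intro N hN
      have hN' := (Finset.mem_Icc.1 hN).1
      have h1 := hG1 N hN'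
      have h3 : lo N < |z| ↔ κ' ^ 2 * (N / G N) < z ^ 2 := by
        rw [← sq_lt_sq₀ (by positivity) (abs_nonneg z), sq_abs, hlo, mul_pow,
          Real.sq_sqrt (by positivity)]
      have h4 : |z| ≤ hi N ↔ z ^ 2 ≤ κ ^ 2 * N := by
        rw [← sq_le_sq₀ (abs_nonneg z) (by positivity), sq_abs, hhi, mul_pow,
          Real.sq_sqrt (by positivity)]
      simp only [midPart, h3, h4]
      split_ifs
      · ring
      · ring
    rw [Finset.sum_congr rfl hmid, ← Finset.sum_filter, ← Finset.mul_sum]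
    split_ifs with hz
    · rw [mul_comm]
      gcongr
      exact sum_weight_le (by omega) (fun N hN => by linarith [hG1 N hN]) hGmono hGs hκ' hκ _
    · rw [Finset.filter_eq_empty_iff.2]
      · simp
      -- `N / L(N)` is nondecreasing, so a value that never exceeds the lower level at `m` is in no
      -- middle range.
      · rintro N hN ⟨h1, -⟩
        refine hz (lt_of_le_of_lt ?_ h1)
        have hN' := (Finset.mem_Icc.1 hN).1
        have hNr := hm1 N hN'
        have hGN := hG1 N hN'
        gcongr κ' ^ 2 * ?_
        rw [div_le_div_iff₀ (by linarith) (by linarith)]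
        have h5 : 1 ≤ (N : ℝ) / m := (one_le_div (by linarith)).2 (by exact_mod_cast hN')
        have h6 : Real.sqrt ((N : ℝ) / m) ≤ N / m := by
          rw [Real.sqrt_le_left (by linarith)]
          nlinarith
        calc (m : ℝ) * G N ≤ m * (G m * (N / m)) := by
              gcongr
              exact (hGs m N le_rfl hN').trans (by gcongr)
          _ = N * lilLog ε m := by field_simp; rfl

/-- A union bound: the number of levels below a value `z` is at most `z²/κ²`, whatever `n` is, which
turns the sum of probabilities into a truncated second moment. -/
theorem high_exists_le (hX : ∀ i, Measurable (X i)) (hid : ∀ n, IdentDistrib (X n) (X 0) P P)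
    (h2 : Integrable (fun ω => X 0 ω ^ 2) P) {m n : ℕ} {κ : ℝ} (hκ : 0 < κ) (b : ℕ → ℝ) :
    P.real {ω | ∃ i < n, highPart (b i) (κ * Real.sqrt (max (i + 1) m : ℕ)) (X i ω) ≠ 0} ≤
      tailMoment X P (κ ^ 2 * m) / κ ^ 2 := by
  have hset : ∀ i N, MeasurableSet {ω | (N : ℝ) < X i ω ^ 2 / κ ^ 2} := fun i N =>
    measurableSet_lt measurable_const (((hX i).pow_const 2).div_const _)
  have h1 : P.real {ω | ∃ i < n, highPart (b i) (κ * Real.sqrt (max (i + 1) m : ℕ)) (X i ω) ≠ 0} ≤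
      ∑ i ∈ Finset.range n, P.real {ω | ((max (i + 1) m : ℕ) : ℝ) < X i ω ^ 2 / κ ^ 2} := by
    refine le_trans (measureReal_mono ?_ (measure_ne_top _ _)) (measureReal_biUnion_finset_le _ _)
    rintro ω ⟨i, hi, h⟩
    exact Set.mem_biUnion (x := i) (by simpa using hi) (sq_gt_of_highPart_ne_zero hκ h)
  refine h1.trans ?_
  have h3 : ∀ i, P.real {ω | ((max (i + 1) m : ℕ) : ℝ) < X i ω ^ 2 / κ ^ 2} =
      ∫ ω, (if ((max (i + 1) m : ℕ) : ℝ) < X 0 ω ^ 2 / κ ^ 2 then (1 : ℝ) else 0) ∂P := by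
    intro i
    have hm' : MeasurableSet {z : ℝ | ((max (i + 1) m : ℕ) : ℝ) < z ^ 2 / κ ^ 2} :=
      measurableSet_lt measurable_const (by fun_prop)
    rw [← integral_comp_eq hid (g := fun z => if ((max (i + 1) m : ℕ) : ℝ) < z ^ 2 / κ ^ 2
      then (1 : ℝ) else 0) (Measurable.ite hm' measurable_const measurable_const) i,
      ← integral_indicator_one (hset i _)]
    refine integral_congr_ae (ae_of_all _ fun ω => ?_)
    simp [Set.indicator_apply]
  have hi3 : ∀ i, Integrable (fun ω => if ((max (i + 1) m : ℕ) : ℝ) < X 0 ω ^ 2 / κ ^ 2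
      then (1 : ℝ) else 0) P := fun i =>
    integrable_of_abs_le (Measurable.ite (hset 0 _) measurable_const measurable_const) (C := 1)
      fun ω => by split_ifs <;> simp
  simp_rw [h3]
  rw [← integral_finsetSum _ fun i _ => hi3 i, tailMoment, ← integral_div]
  refine integral_mono (integrable_finsetSum _ fun i _ => hi3 i)
    ((integrable_tail hX h2 _).div_const _) fun ω => ?_
  dsimp only
  rw [Finset.sum_boole]
  refine (card_level_le (by positivity)).trans ?_
  have e : (m : ℝ) < X 0 ω ^ 2 / κ ^ 2 ↔ κ ^ 2 * m < X 0 ω ^ 2 := by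
    rw [lt_div_iff₀ (by positivity), mul_comm]
  simp only [e]
  split_ifs
  · exact min_le_right _ _
  · simp

end Decomposition

/-! ### Assembling the parts and passing to the infinite horizon. -/

section Crossing

variable {Ω : Type*} [MeasurableSpace Ω] {X : ℕ → Ω → ℝ} {P : Measure Ω} [IsProbabilityMeasure P]

theorem measureReal_exists_abs_partialSum_ge_le (hX : ∀ i, Measurable (X i))
    (hind : iIndepFun X P) (hid : ∀ n, IdentDistrib (X n) (X 0) P P) (h1 : Integrable (X 0) P)
    (h0 : ∫ ω, X 0 ω ∂P = 0) (h2 : Integrable (fun ω => X 0 ω ^ 2) P)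
    (h21 : ∫ ω, X 0 ω ^ 2 ∂P ≤ 1) {ε : ℝ} (hε : 0 < ε) {m n : ℕ} (hm : 2 ≤ m) (hmn : m ≤ n)
    (hlog : 2 ≤ Real.log ((1 + ε) ^ 2 * m)) {r C ψ κ' κ β x b : ℝ} (hr : 1 < r) (hC : 0 < C)
    (hψ : 0 < ψ) (hκ' : 0 < κ') (hκ : 0 < κ) (hu : κ' * C * r ≤ Real.log ψ) (hβ : 0 < β)
    (hbd : ∀ θ, 1 / r ≤ θ → θ ≤ r → (1 + ε) + C ^ 2 * ψ * θ ^ 2 / 2 ≤ C * β * θ)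
    (hrε : r ^ 4 ≤ 1 + ε) (hs : (2 : ℝ) ^ (-ε) * Real.log (1 + ε) ≤ Real.log (r ^ 4))
    (hx : 0 < x) (hb : β + x + tailMoment X P (κ ^ 2 * m) / κ ≤ b) :
    P.real {ω | ∃ k : ℕ, m ≤ k ∧ k ≤ n ∧ b * Real.sqrt (k * lilLog ε k) ≤ |partialSum X k ω|} ≤
      zetaReal (1 + ε) / ε * (Real.log (1 + ε) / Real.log m) ^ ε +
      tailMoment X P (κ ^ 2 * m) / κ ^ 2 +
      (1 + 3 * Real.sqrt (κ / κ')) / x ^ 2 * tailMoment X P (κ' ^ 2 * (m / lilLog ε m)) := by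
  have hlow := low_le (n := n) hX hind hid h2 h21 hε hm hlog hr hC hψ hκ' hu hβ hbd hrε hs
  have hmid := mid_le hX hind hid h2 hε (by omega : 1 ≤ m) hmn hlog hκ' hκ hx
  have hhigh := high_exists_le (n := n) (m := m) hX hid h2 hκ
    (fun i => κ' * Real.sqrt ((max (i + 1) m : ℕ) / lilLog ε (max (i + 1) m : ℕ)))
  have hmean : ∀ k, _ := fun k => sum_abs_integral_highPart_le (k := k) (m := m) hX hid h1 h2 hκ
    (fun i => κ' * Real.sqrt ((max (i + 1) m : ℕ) / lilLog ε (max (i + 1) m : ℕ)))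
  set lo : ℕ → ℝ := fun i =>
    κ' * Real.sqrt ((max (i + 1) m : ℕ) / lilLog ε (max (i + 1) m : ℕ)) with hlo
  set hi : ℕ → ℝ := fun i => κ * Real.sqrt (max (i + 1) m : ℕ) with hhi
  set τ := tailMoment X P (κ ^ 2 * m)
  have hlo0 : ∀ i, 0 ≤ lo i := fun i => by positivity
  have hhi0 : ∀ i, 0 ≤ hi i := fun i => by positivity
  have hXi : ∀ i, Integrable (X i) P := fun i => (hid i).integrable_iff.2 h1
  have hil : ∀ i, Integrable (fun ω => lowPart (lo i) (X i ω)) P := fun i =>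
    integrable_of_abs_le ((measurable_lowPart _).comp (hX i)) fun ω => abs_lowPart_le (hlo0 i) _
  have him : ∀ i, Integrable (fun ω => midPart (lo i) (hi i) (X i ω)) P := fun i =>
    integrable_of_abs_le ((measurable_midPart _ _).comp (hX i)) fun ω => abs_midPart_le (hhi0 i) _
  -- Mean zero converts the centerings of the low and middle parts into the mean of the high part.
  have hmeans : ∀ i, ∫ ω, lowPart (lo i) (X i ω) ∂P + ∫ ω, midPart (lo i) (hi i) (X i ω) ∂P =
      - ∫ ω, highPart (lo i) (hi i) (X i ω) ∂P := by
    intro i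
    have e : ∀ ω, highPart (lo i) (hi i) (X i ω) =
        X i ω - (lowPart (lo i) (X i ω) + midPart (lo i) (hi i) (X i ω)) := fun ω => by
      linarith [lowPart_add_midPart_add_highPart (lo i) (hi i) (X i ω)]
    have hXm : ∫ ω, X i ω ∂P = 0 := by rw [(hid i).integral_eq, h0]
    have hadd : Integrable (fun ω => lowPart (lo i) (X i ω) + midPart (lo i) (hi i) (X i ω)) P :=
      (hil i).add (him i)
    simp_rw [e]
    rw [integral_sub (hXi i) hadd, integral_add (hil i) (him i), hXm]
    ring
  refine le_trans (measureReal_mono ?_) ((measureReal_union_le _ _).trans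
    (add_le_add ((measureReal_union_le _ _).trans (add_le_add hlow hhigh)) hmid))
  rintro ω ⟨k, hmk, hkn, hk⟩
  by_contra hcon
  simp only [Set.mem_union, Set.mem_ofPred_eq, not_or, not_exists, not_and, not_le] at hcon
  obtain ⟨⟨hc1, hc2⟩, hc3⟩ := hcon
  have hl := hc1 k hmk hkn
  have hm' := hc3 k hmk hkn
  have hkr : (1 : ℝ) ≤ k := by exact_mod_cast (by omega : 1 ≤ k)
  have hG := four_thirds_le_lilLog hε hkr
  have hdec : partialSum X k ω =
      ∑ i ∈ Finset.range k, (lowPart (lo i) (X i ω) - ∫ ω', lowPart (lo i) (X i ω') ∂P) +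
      ∑ i ∈ Finset.range k,
        (midPart (lo i) (hi i) (X i ω) - ∫ ω', midPart (lo i) (hi i) (X i ω') ∂P) -
      ∑ i ∈ Finset.range k, ∫ ω', highPart (lo i) (hi i) (X i ω') ∂P := by
    rw [partialSum, ← Finset.sum_add_distrib, ← Finset.sum_sub_distrib]
    refine Finset.sum_congr rfl fun i hi' => ?_
    have hz : highPart (lo i) (hi i) (X i ω) = 0 := by
      by_contra h
      exact hc2 i (by have := Finset.mem_range.1 hi'; omega) h
    have := lowPart_add_midPart_add_highPart (lo i) (hi i) (X i ω)
    have := hmeans i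
    linarith
  -- `L ≥ 1` lets the bound by `√k` be absorbed in `√(k L(k))`.
  have hmk' : |∑ i ∈ Finset.range k, ∫ ω', highPart (lo i) (hi i) (X i ω') ∂P| ≤
      τ / κ * Real.sqrt (k * lilLog ε k) := by
    refine (Finset.abs_sum_le_sum_abs _ _).trans ((hmean k).trans ?_)
    rw [mul_comm]
    have : 0 ≤ τ := tailMoment_nonneg _
    gcongr
    nlinarith
  rw [hdec] at hk
  have t1 := abs_sub (∑ i ∈ Finset.range k, (lowPart (lo i) (X i ω) - ∫ ω', lowPart (lo i) (X i ω') ∂P) +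
      ∑ i ∈ Finset.range k,
        (midPart (lo i) (hi i) (X i ω) - ∫ ω', midPart (lo i) (hi i) (X i ω') ∂P))
      (∑ i ∈ Finset.range k, ∫ ω', highPart (lo i) (hi i) (X i ω') ∂P)
  have t2 := abs_add_le (∑ i ∈ Finset.range k, (lowPart (lo i) (X i ω) - ∫ ω', lowPart (lo i) (X i ω') ∂P))
      (∑ i ∈ Finset.range k,
        (midPart (lo i) (hi i) (X i ω) - ∫ ω', midPart (lo i) (hi i) (X i ω') ∂P))
  have t3 := mul_le_mul_of_nonneg_right hb (Real.sqrt_nonneg (k * lilLog ε k))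
  linarith

theorem cConst_pos {ε : ℝ} (hε : 0 < ε) : 0 < cConst ε := by
  unfold cConst
  positivity

/-- The supremum may equal one without being attained, so the finite-horizon events use a constant
`b` strictly below `c_ε`: if none occurs, the supremum is at most `b / c_ε < 1`. Continuity from
below then removes the horizon. -/
theorem crossingProb_le_of_horizon {ε b B : ℝ} (hε : 0 < ε) {m : ℕ} (hm : 1 ≤ m) (hb : 0 < b)
    (hbc : b < cConst ε) (h : ∀ n, m ≤ n → P.real {ω | ∃ k : ℕ, m ≤ k ∧ k ≤ n ∧
      b * Real.sqrt (k * lilLog ε k) ≤ |partialSum X k ω|} ≤ B) :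
    crossingProb X P ε m ≤ ENNReal.ofReal B := by
  set E : ℕ → Set Ω := fun n => {ω | ∃ k : ℕ, m ≤ k ∧ k ≤ n ∧
      b * Real.sqrt (k * lilLog ε k) ≤ |partialSum X k ω|} with hE
  have hmono : Monotone E := fun n n' hnn ω ⟨k, h1, h2, h3⟩ => ⟨k, h1, h2.trans hnn, h3⟩
  have hsub : {ω | 1 ≤ ⨆ k : ℕ, ⨆ _ : m ≤ k,
      ENNReal.ofReal (|partialSum X k ω| / lilBoundary ε k)} ⊆ ⋃ n, E n := by
    intro ω hω
    by_contra hcon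
    simp only [hE, Set.mem_iUnion, Set.mem_ofPred_eq, not_exists, not_and, not_le] at hcon
    have hle : (⨆ k : ℕ, ⨆ _ : m ≤ k, ENNReal.ofReal (|partialSum X k ω| / lilBoundary ε k)) ≤
        ENNReal.ofReal (b / cConst ε) := by
      refine iSup₂_le fun k hk => ENNReal.ofReal_le_ofReal ?_
      have hkr : (1 : ℝ) ≤ k := by exact_mod_cast hm.trans hk
      have hG := four_thirds_le_lilLog hε hkr
      have hc := cConst_pos hε
      have hs : 0 < Real.sqrt (k * lilLog ε k) := Real.sqrt_pos.2 (by nlinarith)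
      rw [lilBoundary_eq, div_le_div_iff₀ (by positivity) hc]
      have := hcon k k hk le_rfl
      nlinarith
    have hlt : ENNReal.ofReal (b / cConst ε) < 1 := by
      rw [ENNReal.ofReal_lt_one, div_lt_one (cConst_pos hε)]
      exact hbc
    exact absurd (lt_of_le_of_lt (le_trans hω hle) hlt) (lt_irrefl _)
  refine (measure_mono hsub).trans ?_
  refine le_of_tendsto (tendsto_measure_iUnion_atTop hmono) ?_
  filter_upwards [Filter.eventually_ge_atTop m] with n hn
  have := h n hn
  rw [Function.comp_apply, ← ofReal_measureReal]
  exact ENNReal.ofReal_le_ofReal this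

theorem crossingProb_le_of_params (hX : ∀ i, Measurable (X i))
    (hind : iIndepFun X P) (hid : ∀ n, IdentDistrib (X n) (X 0) P P) (h1 : Integrable (X 0) P)
    (h0 : ∫ ω, X 0 ω ∂P = 0) (h2 : Integrable (fun ω => X 0 ω ^ 2) P)
    (h21 : ∫ ω, X 0 ω ^ 2 ∂P ≤ 1) {ε : ℝ} (hε : 0 < ε) {m : ℕ} (hm : 2 ≤ m)
    (hlog : 2 ≤ Real.log ((1 + ε) ^ 2 * m)) {r C ψ κ' κ β x : ℝ} (hr : 1 < r) (hC : 0 < C)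
    (hψ : 0 < ψ) (hκ' : 0 < κ') (hκ : 0 < κ) (hu : κ' * C * r ≤ Real.log ψ) (hβ : 0 < β)
    (hbd : ∀ θ, 1 / r ≤ θ → θ ≤ r → (1 + ε) + C ^ 2 * ψ * θ ^ 2 / 2 ≤ C * β * θ)
    (hrε : r ^ 4 ≤ 1 + ε) (hs : (2 : ℝ) ^ (-ε) * Real.log (1 + ε) ≤ Real.log (r ^ 4))
    (hx : 0 < x) (hb : β + x + tailMoment X P (κ ^ 2 * m) / κ < cConst ε) :
    crossingProb X P ε m ≤ ENNReal.ofReal (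
      zetaReal (1 + ε) / ε * (Real.log (1 + ε) / Real.log m) ^ ε +
      tailMoment X P (κ ^ 2 * m) / κ ^ 2 +
      (1 + 3 * Real.sqrt (κ / κ')) / x ^ 2 * tailMoment X P (κ' ^ 2 * (m / lilLog ε m))) := by
  have hτ : 0 ≤ tailMoment X P (κ ^ 2 * m) / κ := div_nonneg (tailMoment_nonneg _) hκ.le
  exact crossingProb_le_of_horizon hε (by omega) (by linarith) hb fun n hmn =>
    measureReal_exists_abs_partialSum_ge_le hX hind hid h1 h0 h2 h21 hε hm hmn hlog hr hC hψ hκ' hκ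
      hu hβ hbd hrε hs hx le_rfl

end Crossing

/-! ### Numerical comparison of the lower truncation level with the cube root of the index. -/

section Parameters

theorem log_mul_sq_nat_ge_two {ε x : ℝ} (h : 8 ≤ (1 + ε) ^ 2 * x) :
    2 ≤ Real.log ((1 + ε) ^ 2 * x) := by
  have h8 : Real.log 8 = 3 * Real.log 2 := by
    rw [show (8 : ℝ) = 2 ^ 3 by norm_num, Real.log_pow]; norm_num
  have := Real.log_le_log (by norm_num) h
  have := Real.log_two_gt_d9
  linarith

/-- The level of truncation exceeds the sixth root of the index when `ε` is small. -/
theorem cbrt_le_level_small {ε y : ℝ} (hε : 0 < ε) (hε4 : ε ≤ 4) (hy : 0 < y)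
    (hN : 262 < ε ^ 2 * y) :
    y ≤ ε ^ 2 / 360 * (y ^ 3 / lilLog ε (y ^ 3)) := by
  -- In terms of `w` the hypothesis gives `ε w > 16`, so `1/ε` and the logarithms are bounded by
  -- powers of `w`, and `L(y³) ≤ log(w³) ≤ 3 (w - 1)`.
  set w := Real.sqrt y with hw
  have hw0 : 0 < w := Real.sqrt_pos.2 hy
  have hyw : y = w ^ 2 := (Real.sq_sqrt hy.le).symm
  have hεw : 16 < ε * w := by
    rw [hyw, ← mul_pow] at hN
    nlinarith [mul_pos hε hw0]
  have hw4 : 4 ≤ w := by nlinarith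
  have hy1 : 1 ≤ y := by rw [hyw]; nlinarith
  have hy31 : 1 ≤ y ^ 3 := one_le_pow₀ hy1
  have hη := log_one_add_pos hε
  have hη3 : ε / 3 ≤ Real.log (1 + ε) := by
    refine le_trans ?_ (Real.le_log_one_add_of_nonneg hε.le)
    rw [div_le_div_iff₀ (by norm_num) (by linarith)]
    nlinarith
  have hz := one_le_zetaReal_and_le hε
  have hie : 1 / ε ≤ w / 16 := by
    rw [div_le_div_iff₀ hε (by norm_num)]
    linarith
  have hly : Real.log (y ^ 3) = 6 * Real.log w := by
    rw [hyw, ← pow_mul, Real.log_pow]; norm_num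
  have hlw : Real.log w ≤ w - 1 := Real.log_le_sub_one_of_pos hw0
  have hlw0 : 0 ≤ Real.log w := Real.log_nonneg (by linarith)
  have hq : Real.log (y ^ 3) / Real.log (1 + ε) ≤ 18 / 16 * w ^ 2 := by
    rw [hly]
    have hw1 : 0 ≤ w - 1 := by linarith
    calc _ ≤ 6 * (w - 1) / (ε / 3) := by
          gcongr
      _ = 18 * (w - 1) * (1 / ε) := by field_simp; ring
      _ ≤ 18 * (w - 1) * (w / 16) := by
          have : 0 ≤ w - 1 := by linarith
          gcongr
      _ ≤ _ := by nlinarith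
  have hG : lilLog ε (y ^ 3) ≤ 3 * (w - 1) := by
    rw [lilLog_eq hε hy31]
    have hq0 : 0 ≤ Real.log (y ^ 3) / Real.log (1 + ε) :=
      div_nonneg (Real.log_nonneg hy31) hη.le
    have h1 : 2 * zetaReal (1 + ε) ≤ 10 / 16 * w := by linarith [hz.2]
    have h2 : 2 + Real.log (y ^ 3) / Real.log (1 + ε) ≤ 20 / 16 * w ^ 2 := by nlinarith
    have h3 : 2 * zetaReal (1 + ε) * (2 + Real.log (y ^ 3) / Real.log (1 + ε)) ≤ w ^ 3 := by
      calc _ ≤ 10 / 16 * w * (20 / 16 * w ^ 2) :=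
            mul_le_mul h1 h2 (by linarith) (by positivity)
        _ = 200 / 256 * w ^ 3 := by ring
        _ ≤ w ^ 3 := by nlinarith [pow_pos hw0 3]
    have h4 := Real.log_le_log (by have := hz.1; positivity) h3
    rw [Real.log_pow w 3] at h4
    push_cast at h4
    linarith
  have hG0 := four_thirds_le_lilLog hε hy31
  rw [mul_div_assoc', le_div_iff₀ (by linarith)]
  have h5 : lilLog ε (y ^ 3) ≤ 262 / 360 * y := by
    rw [hyw] at hG ⊢
    nlinarith
  calc y * lilLog ε (y ^ 3) ≤ y * (262 / 360 * y) := by gcongr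
    _ = 262 / 360 * y ^ 2 := by ring
    _ ≤ ε ^ 2 * y / 360 * y ^ 2 := by gcongr
    _ = _ := by ring

theorem cbrt_le_level_large {ε y : ℝ} (hε : 4 ≤ ε) (hy : 1 ≤ y) (h : 198 / 20 < y) :
    y ≤ 109 / 1000 * (y ^ 3 / lilLog ε (y ^ 3)) := by
  have hε0 : 0 < ε := by linarith
  have hy31 : 1 ≤ y ^ 3 := one_le_pow₀ hy
  have hη := log_one_add_pos hε0
  have hη4 : 4 / 3 ≤ Real.log (1 + ε) := by
    refine le_trans ?_ (Real.le_log_one_add_of_nonneg hε0.le)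
    rw [div_le_div_iff₀ (by norm_num) (by linarith)]
    nlinarith
  have hz := one_le_zetaReal_and_le hε0
  have hie : 1 / ε ≤ 1 / 4 := by gcongr
  have hly : Real.log (y ^ 3) ≤ 3 * y := by
    rw [Real.log_pow]
    have := Real.log_le_sub_one_of_pos (show 0 < y by linarith)
    push_cast
    linarith
  have hq : Real.log (y ^ 3) / Real.log (1 + ε) ≤ 9 / 4 * y := by
    rw [div_le_iff₀ hη]
    nlinarith
  have hq0 : 0 ≤ Real.log (y ^ 3) / Real.log (1 + ε) := div_nonneg (Real.log_nonneg hy31) hη.le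
  have hG : lilLog ε (y ^ 3) ≤ 9 / 10 * y := by
    rw [lilLog_eq hε0 hy31]
    set A := 2 * zetaReal (1 + ε) * (2 + Real.log (y ^ 3) / Real.log (1 + ε)) with hA
    have hA0 : 0 < A := by have := hz.1; positivity
    have h3 : A ≤ 5 / 2 * (2 + 9 / 4 * y) :=
      mul_le_mul (by linarith [hz.2]) (by linarith) (by linarith) (by norm_num)
    have h8 : Real.log 8 = 3 * Real.log 2 := by
      rw [show (8 : ℝ) = 2 ^ 3 by norm_num, Real.log_pow]; norm_num
    have h5 := Real.log_le_sub_one_of_pos (show 0 < A / 8 by positivity)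
    rw [Real.log_div hA0.ne' (by norm_num)] at h5
    have := Real.log_two_lt_d9
    linarith
  have hG0 := four_thirds_le_lilLog hε0 hy31
  rw [mul_div_assoc', le_div_iff₀ (by linarith)]
  calc y * lilLog ε (y ^ 3) ≤ y * (9 / 10 * y) := by gcongr
    _ = y ^ 2 * (9 / 10) := by ring
    _ ≤ y ^ 2 * (109 / 1000 * y) := by gcongr; linarith
    _ = _ := by ring

theorem two_rpow_neg_mul_log_le {ε : ℝ} (hε : 4 ≤ ε) :
    (2 : ℝ) ^ (-ε) * Real.log (1 + ε) ≤ Real.log (6 / 5) := by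
  have h1 : 1 / 6 ≤ Real.log (6 / 5) := by
    have := Real.one_sub_inv_le_log_of_pos (show (0 : ℝ) < 6 / 5 by norm_num)
    norm_num at this ⊢
    linarith
  have h2 : Real.log (1 + ε) ≤ 2 + (ε - 4) / 5 := by
    have h3 := Real.log_le_sub_one_of_pos (show 0 < (1 + ε) / 8 by linarith)
    rw [Real.log_div (by linarith) (by norm_num)] at h3
    have h8 : Real.log 8 = 3 * Real.log 2 := by
      rw [show (8 : ℝ) = 2 ^ 3 by norm_num, Real.log_pow]; norm_num
    have := Real.log_two_lt_d9
    linarith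
  have h4 : 16 * (1 + (ε - 4) * (1 / 2)) ≤ (2 : ℝ) ^ ε := by
    have e : (2 : ℝ) ^ ε = 16 * (2 : ℝ) ^ (ε - 4) := by
      rw [Real.rpow_sub (by norm_num)]
      norm_num
      ring
    rw [e, Real.rpow_def_of_pos (by norm_num)]
    have h5 := Real.add_one_le_exp (Real.log 2 * (ε - 4))
    have := Real.log_two_gt_d9
    nlinarith
  rw [Real.rpow_neg (by norm_num), inv_mul_le_iff₀ (by positivity)]
  nlinarith

end Parameters

/-! ### Explicit parameters for `ε ≤ 4` and `ε ≥ 4`. -/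

section Parameters

theorem one_add_eq_rpow_pow {ε : ℝ} (hε : 0 < ε) : ((1 + ε) ^ (1 / 4 : ℝ)) ^ 4 = 1 + ε := by
  rw [← Real.rpow_natCast, ← Real.rpow_mul (by linarith)]
  norm_num

theorem cConst_eq {ε : ℝ} (hε : 0 < ε) : cConst ε =
    (((1 + ε) ^ (1 / 4 : ℝ)) ^ 5 + ((1 + ε) ^ (1 / 4 : ℝ)) ^ 3) / Real.sqrt 2 := by
  rw [cConst, ← Real.rpow_natCast, ← Real.rpow_mul (by linarith), ← Real.rpow_natCast,
    ← Real.rpow_mul (by linarith)]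
  norm_num

/-- Admissible parameters of the decomposition, with a truncation level that is bounded below. -/
structure LilParams (ε r C ψ κ' β x : ℝ) : Prop where
  one_lt_r : 1 < r
  C_pos : 0 < C
  ψ_pos : 0 < ψ
  κ'_pos : 0 < κ'
  mul_le_log : κ' * C * r ≤ Real.log ψ
  β_pos : 0 < β
  boundary : ∀ θ, 1 / r ≤ θ → θ ≤ r → (1 + ε) + C ^ 2 * ψ * θ ^ 2 / 2 ≤ C * β * θ
  r_le : r ^ 4 ≤ 1 + ε
  le_log_r : (2 : ℝ) ^ (-ε) * Real.log (1 + ε) ≤ Real.log (r ^ 4)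
  x_pos : 0 < x
  add_lt : β + x + 8 * ε / 262 < cConst ε

/-- With `r = (1+ε)^{1/4}` the block ratio is `1 + ε` and `c_ε = r β`. One factor `r = √ψ` in `β`
pays for truncation; the surplus `(r - 1) β ≥ 0.35 ε` pays for `x = 0.3 ε` and the means. -/
theorem exists_lilParams_small {ε : ℝ} (hε : 0 < ε) (hε4 : ε ≤ 4) :
    ∃ r C ψ κ' β x : ℝ, LilParams ε r C ψ κ' β x ∧ ε ^ 2 / 360 ≤ κ' ^ 2 ∧
      (1 + 3 * Real.sqrt (ε / 8 / κ')) / x ^ 2 ≤ 198 / ε ^ 2 := by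
  set r := (1 + ε) ^ (1 / 4 : ℝ) with hr
  have hr4 : r ^ 4 = 1 + ε := one_add_eq_rpow_pow hε
  have hr0 : 0 < r := by positivity
  have hr1 : 1 < r := Real.one_lt_rpow (by linarith) (by norm_num)
  have hη := log_one_add_pos hε
  have hηr : Real.log (1 + ε) = 4 * Real.log r := by rw [← hr4, Real.log_pow]; norm_num
  have hlr : ε / 12 ≤ Real.log r := by
    have : ε / 3 ≤ Real.log (1 + ε) := by
      refine le_trans ?_ (Real.le_log_one_add_of_nonneg hε.le)
      rw [div_le_div_iff₀ (by norm_num) (by linarith)]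
      nlinarith
    linarith
  have h2 : 0 < Real.sqrt 2 := by positivity
  have h22 : Real.sqrt 2 * Real.sqrt 2 = 2 := Real.mul_self_sqrt (by norm_num)
  have h2l : 1.414 ≤ Real.sqrt 2 := Real.le_sqrt_of_sq_le (by norm_num)
  have h2u : Real.sqrt 2 ≤ 1.415 := Real.sqrt_le_iff.2 ⟨by norm_num, by norm_num⟩
  have hr2 : r ^ 2 ≤ 9 / 4 := by nlinarith [sq_nonneg r]
  have hlr0 : 0 < Real.log r := Real.log_pos hr1
  refine ⟨r, Real.sqrt 2 * r, r ^ 2, Real.sqrt 2 * Real.log r / r ^ 2, (r ^ 4 + r ^ 2) / Real.sqrt 2,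
    3 / 10 * ε, ⟨hr1, by positivity, by positivity, by positivity, ?_, by positivity, ?_, hr4.le, ?_,
    by positivity, ?_⟩, ?_, ?_⟩
  · rw [Real.log_pow]
    have : Real.sqrt 2 * Real.log r / r ^ 2 * (Real.sqrt 2 * r) * r =
        (Real.sqrt 2 * Real.sqrt 2) * Real.log r := by field_simp
    rw [this, h22]
    norm_num
  · intro θ h1 h3
    rw [div_le_iff₀ hr0] at h1
    have hθ0 : 0 < θ := by
      by_contra h
      have : θ * r ≤ 0 := mul_nonpos_of_nonpos_of_nonneg (not_lt.1 h) hr0.le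
      linarith
    have e1 : (Real.sqrt 2 * r) ^ 2 * r ^ 2 * θ ^ 2 / 2 = r ^ 4 * θ ^ 2 := by
      rw [mul_pow, Real.sq_sqrt (by norm_num)]
      ring
    have e2 : Real.sqrt 2 * r * ((r ^ 4 + r ^ 2) / Real.sqrt 2) * θ = r ^ 3 * ((r ^ 2 + 1) * θ) := by
      field_simp
    rw [e1, e2, ← hr4]
    -- This is `(r - θ)(r θ - 1) ≥ 0`, with equality at both ends of the block.
    have h5 : r * (1 + θ ^ 2) ≤ (r ^ 2 + 1) * θ := by
      nlinarith [mul_nonneg (sub_nonneg.2 h3) (sub_nonneg.2 h1)]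
    calc r ^ 4 + r ^ 4 * θ ^ 2 = r ^ 3 * (r * (1 + θ ^ 2)) := by ring
      _ ≤ _ := by gcongr
  · rw [hr4]
    have : (2 : ℝ) ^ (-ε) ≤ 1 := Real.rpow_le_one_of_one_le_of_nonpos (by norm_num) (by linarith)
    nlinarith
  · rw [cConst_eq hε, ← hr]
    have e : (r ^ 5 + r ^ 3) / Real.sqrt 2 =
        (r ^ 4 + r ^ 2) / Real.sqrt 2 + (r - 1) * (r ^ 4 + r ^ 2) / Real.sqrt 2 := by ring
    rw [e]
    have hε' : ε = r ^ 4 - 1 := by linarith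
    have h5 : 35 / 100 * ε ≤ (r - 1) * (r ^ 4 + r ^ 2) / Real.sqrt 2 := by
      rw [le_div_iff₀ h2]
      have h6 : ε / 2 ≤ (r - 1) * (r ^ 4 + r ^ 2) := by
        rw [hε']
        have : 0 ≤ (r - 1) * (r ^ 2 + 1) * ((2 * r ^ 2 - r - 1) / 2) := by
          have h7 : 0 ≤ 2 * r ^ 2 - r - 1 := by nlinarith
          have h8 : 0 ≤ r - 1 := by linarith
          positivity
        nlinarith
      nlinarith
    linarith
  · rw [div_pow, mul_pow, Real.sq_sqrt (by norm_num), le_div_iff₀ (by positivity)]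
    have : (ε / 12) ^ 2 ≤ Real.log r ^ 2 := by gcongr
    have e : (r ^ 2) ^ 2 = 1 + ε := by rw [← hr4]; ring
    rw [e]
    nlinarith [sq_nonneg ε]
  · have hs : Real.sqrt (ε / 8 / (Real.sqrt 2 * Real.log r / r ^ 2)) ≤ 2 := by
      rw [Real.sqrt_le_left (by norm_num), div_div_eq_mul_div, div_le_iff₀ (by positivity)]
      calc ε / 8 * r ^ 2 ≤ ε / 8 * (9 / 4) := by gcongr
        _ ≤ 2 ^ 2 * (1.414 * (ε / 12)) := by linarith
        _ ≤ _ := by gcongr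
    rw [div_le_div_iff₀ (by positivity) (by positivity)]
    nlinarith [sq_nonneg ε]

/-- Block ratio `1 + ε` would send `κ'` to zero as `ε` grows, so the ratio is fixed at `6/5`. There
is room in `c_ε`, which grows like `w⁵` for `w = (1+ε)^{1/4}` while `β` grows like `w⁴`. -/
theorem exists_lilParams_large {ε : ℝ} (hε : 4 ≤ ε) :
    ∃ r C ψ κ' β x : ℝ, LilParams ε r C ψ κ' β x ∧ 109 / 1000 ≤ κ' ^ 2 ∧
      (1 + 3 * Real.sqrt (ε / 8 / κ')) / x ^ 2 ≤ 20 / ε ^ 2 := by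
  have hε0 : 0 < ε := by linarith
  set r : ℝ := (6 / 5) ^ (1 / 4 : ℝ) with hr
  have hr4 : r ^ 4 = 6 / 5 := by
    rw [hr, ← Real.rpow_natCast, ← Real.rpow_mul (by norm_num)]
    norm_num
  have hr0 : 0 < r := by positivity
  have hr1 : 1 < r := Real.one_lt_rpow (by norm_num) (by norm_num)
  have hru : r ≤ 1.0468 := by
    by_contra h
    have : (1.0468 : ℝ) ^ 4 < r ^ 4 := by gcongr; exact not_le.1 h
    rw [hr4] at this
    norm_num at this
  set w := (1 + ε) ^ (1 / 4 : ℝ) with hw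
  have hw4 : w ^ 4 = 1 + ε := one_add_eq_rpow_pow hε0
  have hw0 : 0 < w := by positivity
  have hw1 : 1.495 ≤ w := by
    by_contra h
    have : w ^ 4 < (1.495 : ℝ) ^ 4 := by gcongr; exact not_le.1 h
    rw [hw4] at this
    norm_num at this
    linarith
  have h2 : 0 < Real.sqrt 2 := by positivity
  have h2u : Real.sqrt 2 ≤ 1.4143 := Real.sqrt_le_iff.2 ⟨by norm_num, by norm_num⟩
  have hl2 := Real.log_two_gt_d9
  have hl2' := Real.log_two_lt_d9
  refine ⟨r, 2, 2, Real.log 2 / (2 * r), (1 + ε) * r / 2 + 2 * r, 35 / 100 * w ^ 5,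
    ⟨hr1, by norm_num, by norm_num, by positivity, ?_, by positivity, ?_, ?_, ?_, by positivity, ?_⟩,
    ?_, ?_⟩
  · apply le_of_eq
    field_simp
  · intro θ h1 h3
    rw [div_le_iff₀ hr0] at h1
    have hθ0 : 0 < θ := by
      by_contra h
      have : θ * r ≤ 0 := mul_nonpos_of_nonpos_of_nonneg (not_lt.1 h) hr0.le
      linarith
    nlinarith [mul_nonneg hθ0.le (sub_nonneg.2 h3),
      mul_nonneg (show 0 ≤ 1 + ε by linarith) (sub_nonneg.2 h1)]
  · rw [hr4]
    linarith
  · rw [hr4]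
    exact two_rpow_neg_mul_log_le hε
  · rw [cConst_eq hε0, ← hw, lt_div_iff₀ h2]
    have hε' : ε = w ^ 4 - 1 := by linarith
    have e1 : (1 + ε) * r / 2 + 2 * r ≤ (w ^ 4 / 2 + 2) * 1.0468 := by
      rw [hw4]
      nlinarith
    have hpos : 0 ≤ (w ^ 4 / 2 + 2) * 1.0468 + 35 / 100 * w ^ 5 + 8 * (w ^ 4 - 1) / 262 := by
      rw [hw4]
      have : 0 < 8 * (1 + ε - 1) / 262 := by linarith
      positivity
    calc _ ≤ ((w ^ 4 / 2 + 2) * 1.0468 + 35 / 100 * w ^ 5 + 8 * (w ^ 4 - 1) / 262) * 1.4143 := by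
          refine mul_le_mul ?_ h2u h2.le hpos
          rw [← hε']
          linarith
      _ < w ^ 5 + w ^ 3 := by
          -- `1.495⁴ < 5 ≤ w⁴`; expanded around this point, the difference of the two sides has
          -- positive coefficients.
          obtain ⟨u, hu'⟩ : ∃ u, w = 1.495 + u := ⟨w - 1.495, by ring⟩
          have hu : 0 ≤ u := by linarith
          rw [hu']
          nlinarith [pow_nonneg hu 2, pow_nonneg hu 3, pow_nonneg hu 4, pow_nonneg hu 5]
  · rw [div_pow, mul_pow, le_div_iff₀ (by positivity)]
    have : r ^ 2 ≤ 1.0468 ^ 2 := by gcongr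
    have : (0.693 : ℝ) ^ 2 ≤ Real.log 2 ^ 2 := by gcongr; linarith
    norm_num at *
    linarith
  · set s := Real.sqrt ε with hs
    have hs2 : s ^ 2 = ε := Real.sq_sqrt hε0.le
    have hs0 : 2 ≤ s := Real.le_sqrt_of_sq_le (by linarith)
    have h1 : Real.sqrt (ε / 8 / (Real.log 2 / (2 * r))) ≤ 0.62 * s := by
      rw [Real.sqrt_le_left (by positivity), div_div_eq_mul_div, div_le_iff₀ (by positivity), mul_pow,
        hs2]
      nlinarith
    have h3 : ε ^ 2 * s ≤ (w ^ 5) ^ 2 := by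
      have h4 : s ≤ w ^ 2 := by
        rw [hs, Real.sqrt_le_left (by positivity)]
        nlinarith
      have h5 : ε ≤ w ^ 4 := by linarith
      calc ε ^ 2 * s ≤ (w ^ 4) ^ 2 * w ^ 2 := by gcongr
        _ = _ := by ring
    rw [div_le_div_iff₀ (by positivity) (by positivity)]
    have h6 : 1 + 3 * Real.sqrt (ε / 8 / (Real.log 2 / (2 * r))) ≤ 2.4 * s := by linarith
    calc _ ≤ 2.4 * s * ε ^ 2 := by gcongr
      _ ≤ _ := by nlinarith

end Parameters

/-! ### The bound for a single `m`. -/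

section Crossing

variable {Ω : Type*} [MeasurableSpace Ω] {X : ℕ → Ω → ℝ} {P : Measure Ω} [IsProbabilityMeasure P]

theorem crossingProb_le (hX : ∀ i, Measurable (X i))
    (hind : iIndepFun X P) (hid : ∀ n, IdentDistrib (X n) (X 0) P P) (h1 : Integrable (X 0) P)
    (h0 : ∫ ω, X 0 ω ∂P = 0) (h2 : Integrable (fun ω => X 0 ω ^ 2) P)
    (h21 : ∫ ω, X 0 ω ^ 2 ∂P ≤ 1) {ε : ℝ} (hε : 0 < ε) {m : ℕ} (hm : 2 ≤ m) :
    crossingProb X P ε m ≤ ENNReal.ofReal (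
      zetaReal (1 + ε) / ε * (Real.log (1 + ε) / Real.log m) ^ ε +
      262 / ε ^ 2 * ((m : ℝ) ^ (-1 / 3 : ℝ) + tailMoment X P ((m : ℝ) ^ (1 / 3 : ℝ)))) := by
  have hm1 : (1 : ℝ) ≤ m := by exact_mod_cast (by omega : 1 ≤ m)
  have hm2 : (2 : ℝ) ≤ m := by exact_mod_cast hm
  set y : ℝ := (m : ℝ) ^ (1 / 3 : ℝ) with hy
  have hy1 : 1 ≤ y := Real.one_le_rpow hm1 (by norm_num)
  have hy0 : 0 < y := by linarith
  have hy3 : y ^ 3 = m := by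
    rw [hy, ← Real.rpow_natCast, ← Real.rpow_mul (by linarith)]
    norm_num
  have hyinv : (m : ℝ) ^ (-1 / 3 : ℝ) = 1 / y := by
    rw [hy, one_div, ← Real.rpow_neg (by linarith)]
    norm_num
  rw [hyinv]
  set τ := tailMoment X P y with hτ
  have hτ0 : 0 ≤ τ := tailMoment_nonneg _
  have hA : 0 ≤ zetaReal (1 + ε) / ε * (Real.log (1 + ε) / Real.log m) ^ ε := by
    have := (one_le_zetaReal_and_le hε).1
    have := log_one_add_pos hε
    have := Real.log_nonneg hm1
    positivity
  -- A probability is at most one, so only `262 (1/y + τ) < ε²` matters; this makes both `1/y` and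
  -- `τ` small relative to `ε²`.
  by_cases htriv : 1 ≤ 262 / ε ^ 2 * (1 / y + τ)
  · refine (prob_le_one (μ := P)).trans ?_
    rw [← ENNReal.ofReal_one]
    exact ENNReal.ofReal_le_ofReal (by linarith)
  have hiy : 0 < 1 / y := by positivity
  rw [not_le, div_mul_eq_mul_div, div_lt_one (by positivity)] at htriv
  have hN : 262 < ε ^ 2 * y := by
    have : 262 * (1 / y) < ε ^ 2 := by linarith
    rwa [mul_one_div, div_lt_iff₀ hy0] at this
  have hτε : 262 * τ ≤ ε ^ 2 := by linarith
  have hκτ : tailMoment X P ((ε / 8) ^ 2 * m) ≤ τ := by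
    refine tailMoment_anti hX h2 ?_
    rw [← hy3]
    have h3 : (ε / 8) ^ 2 * y ^ 3 = ε ^ 2 * y / 64 * y ^ 2 := by ring
    rw [h3]
    nlinarith
  have hκ0 : 0 ≤ tailMoment X P ((ε / 8) ^ 2 * m) := tailMoment_nonneg _
  have hlog : 2 ≤ Real.log ((1 + ε) ^ 2 * m) := by
    refine log_mul_sq_nat_ge_two ?_
    rcases le_total ε 4 with h | h
    · have hy16 : 16 ≤ y := by
        have h3 : ε ^ 2 ≤ 16 := by nlinarith
        nlinarith
      have : 16 ^ 3 ≤ y ^ 3 := by gcongr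
      rw [hy3] at this
      nlinarith [sq_nonneg ε]
    · nlinarith
  have main : ∀ r C ψ κ' β x : ℝ, LilParams ε r C ψ κ' β x →
      (1 + 3 * Real.sqrt (ε / 8 / κ')) / x ^ 2 * tailMoment X P (κ' ^ 2 * (m / lilLog ε m)) ≤
        198 / ε ^ 2 * (1 / y + τ) →
      crossingProb X P ε m ≤ ENNReal.ofReal (
        zetaReal (1 + ε) / ε * (Real.log (1 + ε) / Real.log m) ^ ε +
        262 / ε ^ 2 * (1 / y + τ)) := by
    intro r C ψ κ' β x hp hV
    -- The upper level uses `κ = ε/8`; with `τ ≤ ε²/262` the means cost at most `8ε/262`.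
    have hb : β + x + tailMoment X P ((ε / 8) ^ 2 * m) / (ε / 8) < cConst ε := by
      refine lt_of_le_of_lt ?_ hp.add_lt
      have h3 : tailMoment X P ((ε / 8) ^ 2 * m) / (ε / 8) ≤ 8 * ε / 262 := by
        rw [div_le_div_iff₀ (by positivity) (by norm_num)]
        nlinarith
      linarith
    refine (crossingProb_le_of_params hX hind hid h1 h0 h2 h21 hε hm hlog hp.one_lt_r hp.C_pos
      hp.ψ_pos hp.κ'_pos (by positivity) hp.mul_le_log hp.β_pos hp.boundary hp.r_le hp.le_log_r
      hp.x_pos hb).trans (ENNReal.ofReal_le_ofReal ?_)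
    have h3 : tailMoment X P ((ε / 8) ^ 2 * m) / (ε / 8) ^ 2 ≤ 64 / ε ^ 2 * (1 / y + τ) := by
      calc _ ≤ (1 / y + τ) / (ε / 8) ^ 2 := by gcongr; linarith
        _ = _ := by field_simp; norm_num
    -- The high parts use `1/κ² = 64/ε²`, which leaves `198/ε²` for the middle parts.
    have e : 262 / ε ^ 2 * (1 / y + τ) =
        64 / ε ^ 2 * (1 / y + τ) + 198 / ε ^ 2 * (1 / y + τ) := by ring
    rw [e]
    linarith
  have hG : 0 < lilLog ε m := by linarith [four_thirds_le_lilLog hε hm1]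
  rcases le_total ε 4 with h | h
  · obtain ⟨r, C, ψ, κ', β, x, hp, hκ', hV⟩ := exists_lilParams_small hε h
    refine main r C ψ κ' β x hp ?_
    have hlev := cbrt_le_level_small hε h hy0 hN
    rw [hy3] at hlev
    have : tailMoment X P (κ' ^ 2 * (m / lilLog ε m)) ≤ 1 / y + τ :=
      (tailMoment_anti hX h2 (hlev.trans (by gcongr))).trans (by linarith)
    exact mul_le_mul hV this (tailMoment_nonneg _) (by positivity)
  · obtain ⟨r, C, ψ, κ', β, x, hp, hκ', hV⟩ := exists_lilParams_large h
    refine main r C ψ κ' β x hp ?_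
    refine (mul_le_mul_of_nonneg_right hV (tailMoment_nonneg _)).trans ?_
    -- For `y ≤ 198/20` the term `198/y` alone covers the coefficient 20, and the truncated moment
    -- is bounded by one.
    rcases lt_or_ge (198 / 20) y with hy' | hy'
    · have hlev := cbrt_le_level_large h hy1 hy'
      rw [hy3] at hlev
      have : tailMoment X P (κ' ^ 2 * (m / lilLog ε m)) ≤ 1 / y + τ :=
        (tailMoment_anti hX h2 (hlev.trans (by gcongr))).trans (by linarith)
      have h3 : 20 / ε ^ 2 ≤ 198 / ε ^ 2 := by gcongr; norm_num
      exact mul_le_mul h3 this (tailMoment_nonneg _) (by positivity)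
    · have h3 : tailMoment X P (κ' ^ 2 * (m / lilLog ε m)) ≤ 1 :=
        (tailMoment_le hX h2 _).trans h21
      have h4 : 20 ≤ 198 * (1 / y) := by
        rw [mul_one_div, le_div_iff₀ hy0]
        linarith
      calc _ ≤ 20 / ε ^ 2 * 1 := by gcongr
        _ = 20 / ε ^ 2 := mul_one _
        _ ≤ (198 * (1 / y + τ)) / ε ^ 2 := by gcongr; linarith
        _ = _ := by ring

end Crossing

/-! ### Convergence of the three series on the right side. -/

section Series

theorem summable_inv_mul_log_rpow {δ : ℝ} (hδ : 0 < δ) :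
    Summable fun n : ℕ => 1 / ((n : ℝ) * Real.log n ^ (1 + δ)) := by
  rw [← summable_nat_add_iff 3]
  have hpos : ∀ n : ℕ, 0 < Real.log ((n : ℝ) + 2) := fun n =>
    Real.log_pos (by have := n.cast_nonneg (α := ℝ); linarith)
  have hterm : ∀ n : ℕ, 1 / (((n + 3 : ℕ) : ℝ) * Real.log ((n + 3 : ℕ) : ℝ) ^ (1 + δ)) ≤
      1 / δ * (Real.log ((n : ℝ) + 2) ^ (-δ) - Real.log (((n + 1 : ℕ) : ℝ) + 2) ^ (-δ)) := by
    intro n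
    have hn := n.cast_nonneg (α := ℝ)
    have e : ((n + 1 : ℕ) : ℝ) + 2 = (n : ℝ) + 3 := by push_cast; ring
    have e' : ((n + 3 : ℕ) : ℝ) = (n : ℝ) + 3 := by push_cast; ring
    rw [e, e']
    have h3 : 0 < Real.log ((n : ℝ) + 3) := Real.log_pos (by linarith)
    have h := mul_sub_mul_rpow_le hδ (hpos n)
      (Real.log_le_log (by linarith) (by linarith : (n : ℝ) + 2 ≤ (n : ℝ) + 3))
    have h4 : 1 / ((n : ℝ) + 3) ≤ Real.log ((n : ℝ) + 3) - Real.log ((n : ℝ) + 2) := by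
      rw [← Real.log_div (by linarith) (by linarith)]
      have := Real.one_sub_inv_le_log_of_pos (show 0 < ((n : ℝ) + 3) / ((n : ℝ) + 2) by positivity)
      refine le_trans (le_of_eq ?_) this
      field_simp
      ring
    have h5 : 0 < Real.log ((n : ℝ) + 3) ^ (-(1 + δ)) := Real.rpow_pos_of_pos h3 _
    rw [one_div δ, inv_mul_eq_div, le_div_iff₀ hδ]
    calc _ = δ * (1 / ((n : ℝ) + 3)) * Real.log ((n : ℝ) + 3) ^ (-(1 + δ)) := by
          rw [Real.rpow_neg h3.le]
          field_simp
      _ ≤ _ := le_trans (by gcongr) h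
  refine summable_of_sum_range_le (c := 1 / δ * Real.log 2 ^ (-δ)) (fun n => ?_) fun n => ?_
  · have : 0 ≤ Real.log ((n + 3 : ℕ) : ℝ) := Real.log_natCast_nonneg _
    positivity
  · refine (Finset.sum_le_sum fun i _ => hterm i).trans ?_
    rw [← Finset.mul_sum, Finset.sum_range_sub' (fun n : ℕ => Real.log ((n : ℝ) + 2) ^ (-δ))]
    have := Real.rpow_pos_of_pos (hpos n) (-δ)
    gcongr
    simpa using this.le

theorem tsum_ofReal_Ici_two_lt_top {f g : ℕ → ℝ} (hg : Summable g)
    (hg0 : ∀ n, 2 ≤ n → 0 ≤ f n) (h : ∀ n, 2 ≤ n → f n ≤ g n) :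
    ∑' m : Set.Ici (2 : ℕ), ENNReal.ofReal (f m) < ∞ := by
  have hs : Summable fun m : Set.Ici (2 : ℕ) => f m :=
    Summable.of_nonneg_of_le (fun m => hg0 m m.2) (fun m => h m m.2) (hg.subtype _)
  exact hs.tsum_ofReal_lt_top

/-- Equivalent to `4 log(3/2) ≤ 3 log m`, which holds from `m = 2` on. It makes `log(2m/3)` positive
and comparable with `log m`. -/
theorem log_le_four_mul_log {m : ℕ} (hm : 2 ≤ m) :
    Real.log m ≤ 4 * Real.log (2 * (m : ℝ) / 3) := by
  have hm2 : (2 : ℝ) ≤ m := by exact_mod_cast hm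
  have e : Real.log (2 * (m : ℝ) / 3) = Real.log m - Real.log (3 / 2) := by
    rw [← Real.log_div (by linarith) (by norm_num)]
    congr 1
    field_simp
  have h1 := Real.log_le_sub_one_of_pos (show (0 : ℝ) < 3 / 2 by norm_num)
  have h2 := Real.log_le_log (by norm_num) hm2
  have := Real.log_two_gt_d9
  rw [e]
  linarith

theorem gaussian_series_lt_top {ε : ℝ} (hε : 0 < ε) :
    ∑' m : Set.Ici (2 : ℕ), ENNReal.ofReal
      (Real.log (1 + ε) ^ ε * ε⁻¹ * zetaReal (1 + ε) /
        ((m : ℝ) * Real.log (2 * (m : ℝ) / 3) ^ (1 + ε))) < ∞ := by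
  have hc : 0 ≤ Real.log (1 + ε) ^ ε * ε⁻¹ * zetaReal (1 + ε) := by
    have := (one_le_zetaReal_and_le hε).1
    have := log_one_add_pos hε
    positivity
  set c := Real.log (1 + ε) ^ ε * ε⁻¹ * zetaReal (1 + ε)
  have hl : ∀ n : ℕ, 2 ≤ n → 0 < Real.log n := fun n hn =>
    Real.log_pos (by exact_mod_cast (by omega : 1 < n))
  refine tsum_ofReal_Ici_two_lt_top
    (f := fun m => c / ((m : ℝ) * Real.log (2 * (m : ℝ) / 3) ^ (1 + ε)))
    (g := fun m => (c * 4 ^ (1 + ε)) * (1 / ((m : ℝ) * Real.log m ^ (1 + ε))))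
    ((summable_inv_mul_log_rpow hε).mul_left _) (fun n hn => ?_) fun n hn => ?_
  · have := log_le_four_mul_log hn
    have := hl n hn
    have : 0 ≤ Real.log (2 * (n : ℝ) / 3) := by linarith
    positivity
  · have h1 := log_le_four_mul_log hn
    have h2 := hl n hn
    have h3 : 0 < Real.log (2 * (n : ℝ) / 3) := by linarith
    have hn0 : (0 : ℝ) < n := by exact_mod_cast (by omega : 0 < n)
    have h4 : Real.log n ^ (1 + ε) ≤ 4 ^ (1 + ε) * Real.log (2 * (n : ℝ) / 3) ^ (1 + ε) := by
      rw [← Real.mul_rpow (by norm_num) h3.le]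
      gcongr
    rw [mul_one_div, div_le_div_iff₀ (by positivity) (by positivity)]
    calc _ = c * n * Real.log n ^ (1 + ε) := by ring
      _ ≤ c * n * (4 ^ (1 + ε) * Real.log (2 * (n : ℝ) / 3) ^ (1 + ε)) := by gcongr
      _ = _ := by ring

theorem power_series_lt_top :
    ∑' m : Set.Ici (2 : ℕ), ENNReal.ofReal ((m : ℝ) ^ (-4 / 3 : ℝ) / Real.log (m : ℝ)) < ∞ := by
  refine tsum_ofReal_Ici_two_lt_top (f := fun m => (m : ℝ) ^ (-4 / 3 : ℝ) / Real.log (m : ℝ))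
    (g := fun m => (m : ℝ) ^ (-4 / 3 : ℝ) / Real.log 2)
    ((Real.summable_nat_rpow.2 (by norm_num)).div_const _) (fun n _ => ?_) fun n hn => ?_
  · have := Real.log_natCast_nonneg n
    positivity
  · have : 0 < Real.log 2 := Real.log_pos (by norm_num)
    have hn2 : (2 : ℝ) ≤ n := by exact_mod_cast hn
    gcongr

theorem moment_series_lt_top {δ : ℝ} (hδ : 0 < δ) {M : ℝ≥0∞} (hM : M < ∞) :
    ∑' m : Set.Ici (2 : ℕ), (1 + M) / ENNReal.ofReal
      ((1 / 3 : ℝ) ^ δ * (m : ℝ) * Real.log (m : ℝ) ^ (1 + δ)) < ∞ := by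
  have h1 : ∀ n : ℕ, 2 ≤ n → 0 < (1 / 3 : ℝ) ^ δ * (n : ℝ) * Real.log (n : ℝ) ^ (1 + δ) := by
    intro n hn
    have : (0 : ℝ) < n := by exact_mod_cast (by omega : 0 < n)
    have := Real.log_pos (show (1 : ℝ) < n by exact_mod_cast (by omega : 1 < n))
    positivity
  have h2 : ∀ m : Set.Ici (2 : ℕ), (1 + M) / ENNReal.ofReal
      ((1 / 3 : ℝ) ^ δ * (m : ℝ) * Real.log (m : ℝ) ^ (1 + δ)) =
      (1 + M) * ENNReal.ofReal (((1 / 3 : ℝ) ^ δ * (m : ℝ) * Real.log (m : ℝ) ^ (1 + δ))⁻¹) := by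
    intro m
    rw [ENNReal.ofReal_inv_of_pos (h1 m m.2), div_eq_mul_inv]
  simp_rw [h2]
  rw [ENNReal.tsum_mul_left]
  refine ENNReal.mul_lt_top (by simpa using hM) ?_
  refine tsum_ofReal_Ici_two_lt_top
    (f := fun m => ((1 / 3 : ℝ) ^ δ * (m : ℝ) * Real.log (m : ℝ) ^ (1 + δ))⁻¹)
    (g := fun m => ((1 / 3 : ℝ) ^ δ)⁻¹ * (1 / ((m : ℝ) * Real.log m ^ (1 + δ))))
    ((summable_inv_mul_log_rpow hδ).mul_left _) (fun n hn => (inv_pos.2 (h1 n hn)).le)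
    fun n _ => le_of_eq ?_
  rw [mul_assoc, mul_inv, one_div ((n : ℝ) * _)]

end Series

/-! ### Termwise comparison with the log moment. -/

section Main

variable {Ω : Type*} [MeasurableSpace Ω] {X : ℕ → Ω → ℝ} {P : Measure Ω}

/-- Where `X₁² > y`, the weight `log^δ y` is below `log^δ(X₁² + 1)`. Working in `[0, ∞]` covers an
infinite moment too. -/
theorem ofReal_tailMoment_mul_le (hX : ∀ i, Measurable (X i))
    (h2 : Integrable (fun ω => X 0 ω ^ 2) P) {δ y : ℝ} (hδ : 0 < δ) (hy : 1 < y) :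
    ENNReal.ofReal (Real.log y ^ δ) * ENNReal.ofReal (tailMoment X P y) ≤ logMoment X P δ := by
  have hly : 0 < Real.log y := Real.log_pos hy
  rw [tailMoment, ofReal_integral_eq_lintegral_ofReal (integrable_tail hX h2 y)
    (ae_of_all _ fun ω => by dsimp only [Pi.zero_apply]; split_ifs <;> positivity), logMoment,
    ← lintegral_const_mul' _ _ ENNReal.ofReal_ne_top]
  refine lintegral_mono fun ω => ?_
  rw [← ENNReal.ofReal_mul (by positivity)]
  refine ENNReal.ofReal_le_ofReal ?_
  split_ifs with h
  · rw [mul_comm]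
    gcongr
    linarith
  · have : 0 ≤ Real.log (X 0 ω ^ 2 + 1) := Real.log_nonneg (by nlinarith [sq_nonneg (X 0 ω)])
    rw [mul_zero]
    positivity

theorem crossingProb_div_le (hX : ∀ i, Measurable (X i)) (hP : P ∈ centeredIID X)
    (hv : evariance (X 0) P ≤ 1) {ε δ : ℝ} (hε : 0 < ε) (hδ : 0 < δ) {m : ℕ} (hm : 2 ≤ m) :
    crossingProb X P ε m / ENNReal.ofReal ((m : ℝ) * Real.log (m : ℝ)) ≤
      ENNReal.ofReal (Real.log (1 + ε) ^ ε * ε⁻¹ * zetaReal (1 + ε) /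
        ((m : ℝ) * Real.log (2 * (m : ℝ) / 3) ^ (1 + ε))) +
      ENNReal.ofReal (262 / ε ^ 2) *
        (ENNReal.ofReal ((m : ℝ) ^ (-4 / 3 : ℝ) / Real.log (m : ℝ)) +
          (1 + logMoment X P δ) /
            ENNReal.ofReal ((1 / 3 : ℝ) ^ δ * (m : ℝ) * Real.log (m : ℝ) ^ (1 + δ))) := by
  obtain ⟨hprob, hind, hid, h1, h0⟩ := hP
  have hL2 : MemLp (X 0) 2 P := (evariance_lt_top_iff_memLp (hX 0).aestronglyMeasurable).1
    (hv.trans_lt ENNReal.one_lt_top)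
  have h2 : Integrable (fun ω => X 0 ω ^ 2) P := hL2.integrable_sq
  have h21 : ∫ ω, X 0 ω ^ 2 ∂P ≤ 1 := by
    have h3 : variance (X 0) P ≤ 1 := by
      rw [variance]
      exact ENNReal.toReal_le_of_le_ofReal (by norm_num) (by simpa using hv)
    rw [variance_eq_sub hL2, h0] at h3
    simpa using h3
  have hm2 : (2 : ℝ) ≤ m := by exact_mod_cast hm
  have hm0 : (0 : ℝ) < m := by linarith
  have hl : 0 < Real.log m := Real.log_pos (by linarith)
  have hη := log_one_add_pos hε
  have hz := (one_le_zetaReal_and_le hε).1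
  set τ := tailMoment X P ((m : ℝ) ^ (1 / 3 : ℝ))
  have hτ : 0 ≤ τ := tailMoment_nonneg _
  set d := ENNReal.ofReal ((m : ℝ) * Real.log (m : ℝ)) with hd
  have hd0 : 0 < (m : ℝ) * Real.log (m : ℝ) := by positivity
  have hdne : d ≠ 0 := (ENNReal.ofReal_pos.2 hd0).ne'
  -- The estimate holds with `log m`, and `log(2m/3)` is a smaller positive denominator.
  have hA : ENNReal.ofReal (zetaReal (1 + ε) / ε * (Real.log (1 + ε) / Real.log m) ^ ε) / d ≤
      ENNReal.ofReal (Real.log (1 + ε) ^ ε * ε⁻¹ * zetaReal (1 + ε) /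
        ((m : ℝ) * Real.log (2 * (m : ℝ) / 3) ^ (1 + ε))) := by
    rw [hd, ← ENNReal.ofReal_div_of_pos hd0]
    refine ENNReal.ofReal_le_ofReal ?_
    have h3 : 0 < Real.log (2 * (m : ℝ) / 3) := by linarith [log_le_four_mul_log hm]
    have h4 : Real.log (2 * (m : ℝ) / 3) ≤ Real.log m :=
      Real.log_le_log (by positivity) (by linarith)
    calc _ = Real.log (1 + ε) ^ ε * ε⁻¹ * zetaReal (1 + ε) /
          ((m : ℝ) * Real.log m ^ (1 + ε)) := by
          rw [Real.div_rpow hη.le hl.le, Real.rpow_add hl, Real.rpow_one]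
          field_simp
      _ ≤ _ := by gcongr
  have hB : ENNReal.ofReal ((m : ℝ) ^ (-1 / 3 : ℝ)) / d =
      ENNReal.ofReal ((m : ℝ) ^ (-4 / 3 : ℝ) / Real.log (m : ℝ)) := by
    rw [hd, ← ENNReal.ofReal_div_of_pos hd0]
    congr 1
    rw [show (-4 / 3 : ℝ) = -1 / 3 - 1 by norm_num, Real.rpow_sub_one hm0.ne', div_div]
  have hC : ENNReal.ofReal τ / d ≤ (1 + logMoment X P δ) /
      ENNReal.ofReal ((1 / 3 : ℝ) ^ δ * (m : ℝ) * Real.log (m : ℝ) ^ (1 + δ)) := by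
    have hy : 1 < (m : ℝ) ^ (1 / 3 : ℝ) := Real.one_lt_rpow (by linarith) (by norm_num)
    have h3 := ofReal_tailMoment_mul_le hX h2 hδ hy
    have h4 : 0 < Real.log ((m : ℝ) ^ (1 / 3 : ℝ)) ^ δ := Real.rpow_pos_of_pos (Real.log_pos hy) _
    -- The factor `(1/3)^δ` comes from the truncation level `m^{1/3}`.
    have e : (1 / 3 : ℝ) ^ δ * (m : ℝ) * Real.log (m : ℝ) ^ (1 + δ) =
        (m : ℝ) * Real.log (m : ℝ) * Real.log ((m : ℝ) ^ (1 / 3 : ℝ)) ^ δ := by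
      rw [Real.log_rpow hm0, Real.mul_rpow (by norm_num) hl.le, Real.rpow_add hl, Real.rpow_one]
      ring
    rw [e, ENNReal.ofReal_mul hd0.le, ← hd]
    have h5 : ENNReal.ofReal τ ≤ (1 + logMoment X P δ) /
        ENNReal.ofReal (Real.log ((m : ℝ) ^ (1 / 3 : ℝ)) ^ δ) := by
      rw [ENNReal.le_div_iff_mul_le (Or.inl (ENNReal.ofReal_pos.2 h4).ne')
        (Or.inl ENNReal.ofReal_ne_top), mul_comm]
      exact h3.trans le_add_self
    refine (ENNReal.div_le_div_right h5 d).trans (le_of_eq ?_)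
    generalize Real.log ((m : ℝ) ^ (1 / 3 : ℝ)) ^ δ = z
    rw [div_eq_mul_inv, div_eq_mul_inv, div_eq_mul_inv,
      ENNReal.mul_inv (Or.inl hdne) (Or.inl ENNReal.ofReal_ne_top)]
    ring
  have hc := crossingProb_le hX hind hid h1 h0 h2 h21 hε hm
  have hq : 0 ≤ (m : ℝ) ^ (-1 / 3 : ℝ) := by positivity
  calc crossingProb X P ε m / d ≤
      (ENNReal.ofReal (zetaReal (1 + ε) / ε * (Real.log (1 + ε) / Real.log m) ^ ε) +
        ENNReal.ofReal (262 / ε ^ 2) *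
          (ENNReal.ofReal ((m : ℝ) ^ (-1 / 3 : ℝ)) + ENNReal.ofReal τ)) / d := by
        rw [← ENNReal.ofReal_add hq hτ, ← ENNReal.ofReal_mul (by positivity),
          ← ENNReal.ofReal_add (by positivity) (by positivity)]
        exact ENNReal.div_le_div_right hc d
    _ = ENNReal.ofReal (zetaReal (1 + ε) / ε * (Real.log (1 + ε) / Real.log m) ^ ε) / d +
        ENNReal.ofReal (262 / ε ^ 2) *
          (ENNReal.ofReal ((m : ℝ) ^ (-1 / 3 : ℝ)) / d + ENNReal.ofReal τ / d) := by
        simp only [div_eq_mul_inv]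
        ring
    _ ≤ _ := by
        rw [hB]
        gcongr

theorem crossingSeries_le (hX : ∀ i, Measurable (X i)) (hP : P ∈ centeredIID X)
    (hv : evariance (X 0) P ≤ 1) {ε δ : ℝ} (hε : 0 < ε) (hδ : 0 < δ) :
    crossingSeries X P ε ≤
      (∑' m : Set.Ici (2 : ℕ), ENNReal.ofReal
        (Real.log (1 + ε) ^ ε * ε⁻¹ * zetaReal (1 + ε) /
          ((m : ℝ) * Real.log (2 * (m : ℝ) / 3) ^ (1 + ε)))) +
      ENNReal.ofReal (262 / ε ^ 2) *
        ((∑' m : Set.Ici (2 : ℕ), ENNReal.ofReal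
            ((m : ℝ) ^ (-4 / 3 : ℝ) / Real.log (m : ℝ))) +
         ∑' m : Set.Ici (2 : ℕ), (1 + logMoment X P δ) /
            ENNReal.ofReal
              ((1 / 3 : ℝ) ^ δ * (m : ℝ) * Real.log (m : ℝ) ^ (1 + δ))) := by
  rw [← ENNReal.tsum_add, ← ENNReal.tsum_mul_left, ← ENNReal.tsum_add]
  exact ENNReal.tsum_le_tsum fun m => crossingProb_div_le hX hP hv hε hδ m.2

end Main

end BaumKatzLIL

theorem mainTheorem7 {Ω : Type*} [MeasurableSpace Ω] (X : ℕ → Ω → ℝ)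
    (hX : ∀ n, Measurable (X n)) :
    (∀ P ∈ BaumKatzLIL.centeredIID X, evariance (X 0) P ≤ 1 →
      ∀ ε : ℝ, 0 < ε → ∀ δ : ℝ, 0 < δ →
        BaumKatzLIL.crossingSeries X P ε ≤
          (∑' m : Set.Ici (2 : ℕ), ENNReal.ofReal
            (Real.log (1 + ε) ^ ε * ε⁻¹ * BaumKatzLIL.zetaReal (1 + ε) /
              ((m : ℝ) * Real.log (2 * (m : ℝ) / 3) ^ (1 + ε)))) +
          ENNReal.ofReal (262 / ε ^ 2) *
            ((∑' m : Set.Ici (2 : ℕ), ENNReal.ofReal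
                ((m : ℝ) ^ (-4 / 3 : ℝ) / Real.log (m : ℝ))) +
             ∑' m : Set.Ici (2 : ℕ), (1 + BaumKatzLIL.logMoment X P δ) /
                ENNReal.ofReal
                  ((1 / 3 : ℝ) ^ δ * (m : ℝ) * Real.log (m : ℝ) ^ (1 + δ)))) ∧
    (∀ Q : Set (Measure Ω), Q ⊆ BaumKatzLIL.centeredIID X →
      (∀ P ∈ Q, evariance (X 0) P = 1) →
      (∃ δ : ℝ, 0 < δ ∧ (⨆ P ∈ Q, BaumKatzLIL.logMoment X P δ) < ∞) →
      ∀ ε : ℝ, 0 < ε → (⨆ P ∈ Q, BaumKatzLIL.crossingSeries X P ε) < ∞) := by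
  refine ⟨fun P hP hv ε hε δ hδ => BaumKatzLIL.crossingSeries_le hX hP hv hε hδ, ?_⟩
  rintro Q hQ hv ⟨δ, hδ, hK⟩ ε hε
  refine lt_of_le_of_lt (iSup₂_le fun P hP => (BaumKatzLIL.crossingSeries_le hX (hQ hP) (hv P hP).le
    hε hδ).trans (b := _) ?_) (ENNReal.add_lt_top.2 ⟨BaumKatzLIL.gaussian_series_lt_top hε,
      ENNReal.mul_lt_top (ENNReal.ofReal_lt_top (r := 262 / ε ^ 2)) (ENNReal.add_lt_top.2
        ⟨BaumKatzLIL.power_series_lt_top, BaumKatzLIL.moment_series_lt_top hδ hK⟩)⟩)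
  gcongr
  exact le_iSup₂ (f := fun P (_ : P ∈ Q) => BaumKatzLIL.logMoment X P δ) P hP
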